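/- Let $m>n\ge 1$, $A\in\mathbb{R}^{m\times n}$, $b\in\mathbb{R}^m$. Write $\hat\sigma_n$ for the smallest singular value of $A$ and, for $\lambda>0$, $\sigma_{n+1}=\sigma_{n+1}(\lambda)$ for the smallest (the $(n+1)$-st) singular value of $[A\ \ \lambda b]$. The scaled total least squares (STLS) problem is to minimise $\|[E\ \ r]\|_F$ subject to $\lambda b-r\in\mathcal{R}(A+E)$; an STLS solution is a vector $x$ with $(A+E)\lambda x=\lambda b-r$ for some minimiser $[E\ \ r]$. The total least squares (TLS) problem is to minimise $\|[E\ \ r]\|_F$ subject to $b-r\in\mathcal{R}(A+E)$, a TLS solution being a vector $x$ with $(A+E)x=b-r$ for some minimiser; the ordinary least squares (OLS) problem is to minimise $\|Ax-b\|_2$. For each of these problems the absolute normwise condition number at $[A\ \ b]$ is the operator norm of the Fréchet derivative at $[A\ \ b]$ of the solution map $[A\ \ b]\mapsto x$ ($\lambda$ fixed), for the Frobenius norm on the data and the Euclidean norm on solutions. $\|\cdot\|$ and $\|\cdot\|_2$ are the Euclidean norm of vectors and the spectral norm of matrices, $\otimes$ is the Kronecker product, and perturbations are vectorised as $(\mathrm{vec}(\Delta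 A),\Delta b)$ with columns stacked. For a symmetric invertible $M\in\mathbb{R}^{n\times n}$, $x\in\mathbb{R}^n$ and $r\in\mathbb{R}^m$ put $$K(M,x,r)=M^{-1}\Big(\big(\tfrac{2}{\|r\|^2}A^Trr^T-A^T\big)\big([x^T\ \ {-1}]\otimes I_m\big)-[I_n\otimes r^T\ \ 0_{n\times m}]\Big),$$ $$\kappa_1(M,x,r)=\big\|M^{-1}\big((1+\|x\|^2)A^TA-A^Trx^T-xr^TA+\|r\|^2I_n\big)M^{-1}\big\|_2^{1/2},$$ $$\kappa_2(M,x,r)=\Big\|M^{-1}\Big[A^T,\ \ \|x\|A^T\big(I_m-\tfrac{1}{\|r\|^2}rr^T\big),\ \ \|r\|\big(I_n-\tfrac{1}{\|r\|^2}A^Trx^T\big)\Big]\Big\|_2,$$ where, if $r=0$, the terms containing $1/\|r\|^2$ are read as $0$. (i) Let $\lambda>0$ and $\hat\sigma_n>\sigma_{n+1}$. Then for all data in a neighbourhood of $[A\ \ b]$ there is exactly one STLS solution. With $x_S$ the STLS solution for $[A\ \ b]$, $M=A^TA-\sigma_{n+1}^2I_n$ and $r=Ax_S-b$, the matrix $M$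 is invertible, $x_S=M^{-1}A^Tb$, the STLS solution map is Fréchet differentiable at $[A\ \ b]$ with derivative $K=K(M,x_S,r)$, and its absolute condition number $\kappa_F$ satisfies $$\kappa_F=\|K\|_2=\kappa_1(M,x_S,r)=\kappa_2(M,x_S,r).$$ (ii) The STLS problem with $\lambda=1$ is the TLS problem. If $\hat\sigma_n>\sigma_{n+1}$ with $\sigma_{n+1}$ the smallest singular value of $[A\ \ b]$, then for all data in a neighbourhood of $[A\ \ b]$ there is exactly one TLS solution, and with $x_T$ the TLS solution for $[A\ \ b]$, $M=A^TA-\sigma_{n+1}^2I_n$ and $r=Ax_T-b$, the TLS solution map is Fréchet differentiable at $[A\ \ b]$ with derivative $K(M,x_T,r)$, and its absolute condition number, which is $\kappa_F$ for $\lambda=1$, equals $\|K(M,x_T,r)\|_2=\kappa_1(M,x_T,r)=\kappa_2(M,x_T,r)$. (iii) Let $A$ have full column rank. Then $\hat\sigma_n>\sigma_{n+1}(\lambda)$ for all sufficiently small $\lambda>0$, and as $\lambda\to0^+$, $\sigma_{n+1}(\lambda)\to0$, $M^{-1}\to(A^TA)^{-1}$ and $x_S\to x_O$, the unique OLS solution;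 moreover $A^Tr_O=0$ for $r_O=Ax_O-b$. The OLS solution is unique for all data near $[A\ \ b]$, and the OLS solution map is Fréchet differentiable at $[A\ \ b]$ with derivative $$K_O=(A^TA)^{-1}\Big(-A^T\big([x_O^T\ \ {-1}]\otimes I_m\big)-[I_n\otimes r_O^T\ \ 0_{n\times m}]\Big);$$ its absolute condition number equals $$\|K_O\|_2=\big\|(A^TA)^{-1}\big((1+\|x_O\|^2)A^TA+\|r_O\|^2I_n\big)(A^TA)^{-1}\big\|_2^{1/2}=\big\|(A^TA)^{-1}\big[A^T,\ \|x_O\|A^T,\ \|r_O\|I_n\big]\big\|_2,$$ and, as $\lambda\to0^+$, the quantities $\kappa_F$, $\kappa_1(M,x_S,r)$ and $\kappa_2(M,x_S,r)$ of (i) converge to these three expressions, respectively. -/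

import Mathlib

open Filter Topology
open scoped Matrix Kronecker

noncomputable section

namespace STLS

variable {m n : ℕ}

/-- Spectral norm of a real matrix, i.e. its operator norm for the Euclidean norms. -/
def specNorm {p q : Type*} [Fintype p] [Fintype q] [DecidableEq q] (X : Matrix p q ℝ) : ℝ :=
  ‖(Matrix.toEuclideanLin X).toContinuousLinearMap‖

/-- The singular values of a real matrix in decreasing order, indexed from `0`:
`sv X k` is the `(k+1)`-st largest singular value. -/
def sv {p q : Type*} [Fintype p] [Fintype q] [DecidableEq q] (X : Matrix p q ℝ) (k : ℕ) : ℝ :=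
  (Matrix.toEuclideanLin X).singularValues k

/-- The matrix `[A b]`. -/
def aug (A : Matrix (Fin m) (Fin n) ℝ) (b : EuclideanSpace ℝ (Fin m)) :
    Matrix (Fin m) (Fin n ⊕ Unit) ℝ :=
  Matrix.fromCols A (Matrix.replicateCol Unit b.ofLp)

/-- The data space of all `[A b]`, vectorised columnwise. Its Euclidean norm is the Frobenius
norm of `[A b]`. -/
abbrev Data (m n : ℕ) := EuclideanSpace ℝ ((Fin n ⊕ Unit) × Fin m)

/-- `vec [A b]`, that is `vec A` stacked on top of `b`. -/
def dataVec (A : Matrix (Fin m) (Fin n) ℝ) (b : EuclideanSpace ℝ (Fin m)) : Data m n :=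
  WithLp.toLp 2 (Matrix.vec (aug A b))

/-- The matrix `A` of the data `vec [A b]`. -/
def dataMat (d : Data m n) : Matrix (Fin m) (Fin n) ℝ :=
  Matrix.of fun i j => d (Sum.inl j, i)

/-- The right-hand side `b` of the data `vec [A b]`. -/
def dataRhs (d : Data m n) : EuclideanSpace ℝ (Fin m) :=
  WithLp.toLp 2 fun i => d (Sum.inr (), i)

/-- The Frobenius norm of `[E r]`. -/
def frob (E : Matrix (Fin m) (Fin n) ℝ) (r : EuclideanSpace ℝ (Fin m)) : ℝ :=
  Real.sqrt (∑ i, ∑ j, aug E r i j ^ 2)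

/-- Residual `A x - b`. -/
def resid (A : Matrix (Fin m) (Fin n) ℝ) (b : EuclideanSpace ℝ (Fin m))
    (x : EuclideanSpace ℝ (Fin n)) : EuclideanSpace ℝ (Fin m) :=
  Matrix.toEuclideanLin A x - b

/-! ### The three least squares problems -/

/-- Constraint `lam b - r ∈ range (A + E)` of the scaled total least squares problem. -/
def STLSFeasible (lam : ℝ) (A : Matrix (Fin m) (Fin n) ℝ) (b : EuclideanSpace ℝ (Fin m))
    (E : Matrix (Fin m) (Fin n) ℝ) (r : EuclideanSpace ℝ (Fin m)) : Prop :=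
  lam • b - r ∈ LinearMap.range (Matrix.toEuclideanLin (A + E))

/-- `x` solves the scaled total least squares problem with parameter `lam`: for some minimiser
`[E r]` of the Frobenius norm under the constraint, `(A + E) (lam x) = lam b - r`. -/
def IsSTLSSolution (lam : ℝ) (A : Matrix (Fin m) (Fin n) ℝ) (b : EuclideanSpace ℝ (Fin m))
    (x : EuclideanSpace ℝ (Fin n)) : Prop :=
  ∃ E r, STLSFeasible lam A b E r ∧
    (∀ E' r', STLSFeasible lam A b E' r' → frob E r ≤ frob E' r') ∧
    Matrix.toEuclideanLin (A + E) (lam • x) = lam • b - r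

/-- Constraint `b - r ∈ range (A + E)` of the total least squares problem. -/
def TLSFeasible (A : Matrix (Fin m) (Fin n) ℝ) (b : EuclideanSpace ℝ (Fin m))
    (E : Matrix (Fin m) (Fin n) ℝ) (r : EuclideanSpace ℝ (Fin m)) : Prop :=
  b - r ∈ LinearMap.range (Matrix.toEuclideanLin (A + E))

/-- `x` solves the total least squares problem. -/
def IsTLSSolution (A : Matrix (Fin m) (Fin n) ℝ) (b : EuclideanSpace ℝ (Fin m))
    (x : EuclideanSpace ℝ (Fin n)) : Prop :=
  ∃ E r, TLSFeasible A b E r ∧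
    (∀ E' r', TLSFeasible A b E' r' → frob E r ≤ frob E' r') ∧
    Matrix.toEuclideanLin (A + E) x = b - r

/-- `x` solves the ordinary least squares problem. -/
def IsOLSSolution (A : Matrix (Fin m) (Fin n) ℝ) (b : EuclideanSpace ℝ (Fin m))
    (x : EuclideanSpace ℝ (Fin n)) : Prop :=
  ∀ y, ‖resid A b x‖ ≤ ‖resid A b y‖

/-- The solution of the scaled total least squares problem (used only where it is unique). -/
def stlsSol (lam : ℝ) (A : Matrix (Fin m) (Fin n) ℝ) (b : EuclideanSpace ℝ (Fin m)) :
    EuclideanSpace ℝ (Fin n) :=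
  Classical.epsilon (IsSTLSSolution lam A b)

/-- The solution of the total least squares problem (used only where it is unique). -/
def tlsSol (A : Matrix (Fin m) (Fin n) ℝ) (b : EuclideanSpace ℝ (Fin m)) :
    EuclideanSpace ℝ (Fin n) :=
  Classical.epsilon (IsTLSSolution A b)

/-- The solution of the ordinary least squares problem (used only where it is unique). -/
def olsSol (A : Matrix (Fin m) (Fin n) ℝ) (b : EuclideanSpace ℝ (Fin m)) :
    EuclideanSpace ℝ (Fin n) :=
  Classical.epsilon (IsOLSSolution A b)

/-! ### Solution maps and absolute condition numbers -/

/-- Solution map `[A b] ↦ x` of the scaled total least squares problem. -/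
def stlsMap (lam : ℝ) (d : Data m n) : EuclideanSpace ℝ (Fin n) :=
  stlsSol lam (dataMat d) (dataRhs d)

/-- Solution map of the total least squares problem. -/
def tlsMap (d : Data m n) : EuclideanSpace ℝ (Fin n) := tlsSol (dataMat d) (dataRhs d)

/-- Solution map of the ordinary least squares problem. -/
def olsMap (d : Data m n) : EuclideanSpace ℝ (Fin n) := olsSol (dataMat d) (dataRhs d)

/-- Absolute normwise condition number of a (differentiable) solution map at `[A b]`: the
operator norm of its Fréchet derivative, for the Frobenius norm on the data and the Euclidean
norm on the solutions. -/
def absCond (F : Data m n → EuclideanSpace ℝ (Fin n)) (A : Matrix (Fin m) (Fin n) ℝ)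
    (b : EuclideanSpace ℝ (Fin m)) : ℝ :=
  ‖fderiv ℝ F (dataVec A b)‖

/-! ### The explicit expressions -/

/-- The matrix `Aᵀ A - s² I`. -/
def gramShift (A : Matrix (Fin m) (Fin n) ℝ) (s : ℝ) : Matrix (Fin n) (Fin n) ℝ :=
  Aᵀ * A - s ^ 2 • 1

/-- The matrix `[xᵀ -1] ⊗ I_m`, of size `m × m (n + 1)`. -/
def kronX (m : ℕ) (x : EuclideanSpace ℝ (Fin n)) :
    Matrix (Fin m) ((Fin n ⊕ Unit) × Fin m) ℝ :=
  ((Matrix.fromCols (Matrix.replicateRow Unit x.ofLp) (-1 : Matrix Unit Unit ℝ)) ⊗ₖ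
    (1 : Matrix (Fin m) (Fin m) ℝ)).submatrix (fun i => ((), i)) id

/-- The matrix `[I_n ⊗ rᵀ  0]`, of size `n × m (n + 1)`. -/
def kronR (n : ℕ) (r : EuclideanSpace ℝ (Fin m)) :
    Matrix (Fin n) ((Fin n ⊕ Unit) × Fin m) ℝ :=
  (Matrix.fromCols ((1 : Matrix (Fin n) (Fin n) ℝ) ⊗ₖ Matrix.replicateRow Unit r.ofLp)
    (0 : Matrix (Fin n × Unit) (Unit × Fin m) ℝ)).submatrix (fun j => (j, ()))
      (Equiv.sumProdDistrib (Fin n) Unit (Fin m))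

/-- `M⁻¹ ((2 / ‖r‖² Aᵀ r rᵀ - Aᵀ) ([xᵀ -1] ⊗ I_m) - [I_n ⊗ rᵀ  0])`. -/
def matK (M : Matrix (Fin n) (Fin n) ℝ) (A : Matrix (Fin m) (Fin n) ℝ)
    (x : EuclideanSpace ℝ (Fin n)) (r : EuclideanSpace ℝ (Fin m)) :
    Matrix (Fin n) ((Fin n ⊕ Unit) × Fin m) ℝ :=
  M⁻¹ * (((2 / ‖r‖ ^ 2) • (Aᵀ * Matrix.vecMulVec r.ofLp r.ofLp) - Aᵀ) * kronX m x - kronR n r)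

/-- `‖M⁻¹ ((1 + ‖x‖²) Aᵀ A - Aᵀ r xᵀ - x rᵀ A + ‖r‖² I_n) M⁻¹‖₂ ^ (1/2)`. -/
def form1 (M : Matrix (Fin n) (Fin n) ℝ) (A : Matrix (Fin m) (Fin n) ℝ)
    (x : EuclideanSpace ℝ (Fin n)) (r : EuclideanSpace ℝ (Fin m)) : ℝ :=
  Real.sqrt (specNorm (M⁻¹ * ((1 + ‖x‖ ^ 2) • (Aᵀ * A) - Aᵀ * Matrix.vecMulVec r.ofLp x.ofLp
    - Matrix.vecMulVec x.ofLp r.ofLp * A + ‖r‖ ^ 2 • 1) * M⁻¹))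

/-- `‖M⁻¹ [Aᵀ  ‖x‖ Aᵀ (I_m - r rᵀ / ‖r‖²)  ‖r‖ (I_n - Aᵀ r xᵀ / ‖r‖²)]‖₂`. -/
def form2 (M : Matrix (Fin n) (Fin n) ℝ) (A : Matrix (Fin m) (Fin n) ℝ)
    (x : EuclideanSpace ℝ (Fin n)) (r : EuclideanSpace ℝ (Fin m)) : ℝ :=
  specNorm (M⁻¹ * Matrix.fromCols Aᵀ (Matrix.fromCols
    (‖x‖ • (Aᵀ * (1 - (1 / ‖r‖ ^ 2) • Matrix.vecMulVec r.ofLp r.ofLp)))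
    (‖r‖ • (1 - (1 / ‖r‖ ^ 2) • (Aᵀ * Matrix.vecMulVec r.ofLp x.ofLp)))))

/-- `(Aᵀ A)⁻¹ (-Aᵀ ([xᵀ -1] ⊗ I_m) - [I_n ⊗ rᵀ  0])`. -/
def olsK (A : Matrix (Fin m) (Fin n) ℝ) (x : EuclideanSpace ℝ (Fin n))
    (r : EuclideanSpace ℝ (Fin m)) : Matrix (Fin n) ((Fin n ⊕ Unit) × Fin m) ℝ :=
  (Aᵀ * A)⁻¹ * (-Aᵀ * kronX m x - kronR n r)

/-- `‖(Aᵀ A)⁻¹ ((1 + ‖x‖²) Aᵀ A + ‖r‖² I_n) (Aᵀ A)⁻¹‖₂ ^ (1/2)`. -/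
def olsForm1 (A : Matrix (Fin m) (Fin n) ℝ) (x : EuclideanSpace ℝ (Fin n))
    (r : EuclideanSpace ℝ (Fin m)) : ℝ :=
  Real.sqrt (specNorm ((Aᵀ * A)⁻¹ * ((1 + ‖x‖ ^ 2) • (Aᵀ * A) + ‖r‖ ^ 2 • 1) * (Aᵀ * A)⁻¹))

/-- `‖(Aᵀ A)⁻¹ [Aᵀ  ‖x‖ Aᵀ  ‖r‖ I_n]‖₂`. -/
def olsForm2 (A : Matrix (Fin m) (Fin n) ℝ) (x : EuclideanSpace ℝ (Fin n))
    (r : EuclideanSpace ℝ (Fin m)) : ℝ :=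
  specNorm ((Aᵀ * A)⁻¹ * Matrix.fromCols Aᵀ (Matrix.fromCols (‖x‖ • Aᵀ)
    (‖r‖ • (1 : Matrix (Fin n) (Fin n) ℝ))))

/-! ### Abbreviations for the scaled and the unscaled total least squares problem -/

/-- `M = Aᵀ A - σ_{n+1}² I` with `σ_{n+1}` the smallest singular value of `[A  lam b]`. -/
def stlsM (lam : ℝ) (A : Matrix (Fin m) (Fin n) ℝ) (b : EuclideanSpace ℝ (Fin m)) :
    Matrix (Fin n) (Fin n) ℝ :=
  gramShift A (sv (aug A (lam • b)) n)

/-- `M = Aᵀ A - σ_{n+1}² I` with `σ_{n+1}` the smallest singular value of `[A b]`. -/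
def tlsM (A : Matrix (Fin m) (Fin n) ℝ) (b : EuclideanSpace ℝ (Fin m)) :
    Matrix (Fin n) (Fin n) ℝ :=
  gramShift A (sv (aug A b) n)

/-- `r = A x - b` at the solution of the scaled total least squares problem. -/
def stlsRes (lam : ℝ) (A : Matrix (Fin m) (Fin n) ℝ) (b : EuclideanSpace ℝ (Fin m)) :
    EuclideanSpace ℝ (Fin m) :=
  resid A b (stlsSol lam A b)

/-- `r = A x - b` at the solution of the total least squares problem. -/
def tlsRes (A : Matrix (Fin m) (Fin n) ℝ) (b : EuclideanSpace ℝ (Fin m)) :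
    EuclideanSpace ℝ (Fin m) :=
  resid A b (tlsSol A b)

/-- `r = A x - b` at the solution of the ordinary least squares problem. -/
def olsRes (A : Matrix (Fin m) (Fin n) ℝ) (b : EuclideanSpace ℝ (Fin m)) :
    EuclideanSpace ℝ (Fin m) :=
  resid A b (olsSol A b)

/-- The Kronecker-product matrix of the scaled total least squares problem. -/
def stlsK (lam : ℝ) (A : Matrix (Fin m) (Fin n) ℝ) (b : EuclideanSpace ℝ (Fin m)) :
    Matrix (Fin n) ((Fin n ⊕ Unit) × Fin m) ℝ :=
  matK (stlsM lam A b) A (stlsSol lam A b) (stlsRes lam A b)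

/-- First Kronecker-free expression for the scaled total least squares problem. -/
def stlsForm1 (lam : ℝ) (A : Matrix (Fin m) (Fin n) ℝ) (b : EuclideanSpace ℝ (Fin m)) : ℝ :=
  form1 (stlsM lam A b) A (stlsSol lam A b) (stlsRes lam A b)

/-- Second Kronecker-free expression for the scaled total least squares problem. -/
def stlsForm2 (lam : ℝ) (A : Matrix (Fin m) (Fin n) ℝ) (b : EuclideanSpace ℝ (Fin m)) : ℝ :=
  form2 (stlsM lam A b) A (stlsSol lam A b) (stlsRes lam A b)

/-- The Kronecker-product matrix of the total least squares problem. -/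
def tlsK (A : Matrix (Fin m) (Fin n) ℝ) (b : EuclideanSpace ℝ (Fin m)) :
    Matrix (Fin n) ((Fin n ⊕ Unit) × Fin m) ℝ :=
  matK (tlsM A b) A (tlsSol A b) (tlsRes A b)

end STLS

end

open STLS

/-! Solutions. Passing from `b`, `x` to `lam • b`, `lam • x` turns STLS into TLS. If (A + E)y = b -
r, then [E r] sends (y, 1) to -(Ay - b), so ‖[E r]‖_F² ≥ ‖Ay - b‖² / (1 + ‖y‖²), with equality for a
rank one correction (`exists_correction`). TLS thus minimises the Rayleigh quotient of [A b] over
vectors (y, -1). Its lower bound σ² is attained, because the gap forces a last right singular vector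
to have nonzero last entry (`exists_resid_eq`). The first variation at a minimiser is Aᵀr = σ²y,
that is My = Aᵀb, and the gap makes M invertible.

Derivative. No differentiability of σ is needed. For STLS the relations Aᵀr = σ²x and c‖r‖² = σ²(1 +
c‖x‖²) with c = λ² eliminate σ and leave the polynomial equation `normalFun`: (1 + c‖x‖²)Aᵀr =
c‖r‖²x. The solution map is continuous, being M⁻¹Aᵀb, and at a solution the partial derivative in x
collapses to (1 + c‖x‖²)M, so implicit differentiation gives K (`hasFDerivAt_of_normalFun`). OLS is
the case c = 0, σ = 0.

Norms. Since ‖X‖₂² = ‖XXᵀ‖₂, it suffices that K and the block matrix of κ₂ have the same product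
XXᵀ, namely the one inside κ₁. For K this holds because 2rrᵀ/‖r‖² - I is orthogonal and fixes r
(`matK_core_mul_transpose`).

Limit. As λ → 0⁺ the bound σ ≤ λ‖b‖ gives M → AᵀA. Since Aᵀr_O = 0, the OLS expressions are the
general ones with M = AᵀA. The expression κ₁ contains no division by ‖r‖, hence is continuous even
at r = 0; the other two limits follow from the equalities. -/

/-- If `F (d, g d) = 0` near `d₀`, `g` is continuous at `d₀`, and `P` inverts the partial derivative
of `F` in the second variable, then `g` is differentiable at `d₀`. -/
theorem HasFDerivAt.of_implicit {D X Z : Type*} [NormedAddCommGroup D] [NormedSpace ℝ D]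
    [NormedAddCommGroup X] [NormedSpace ℝ X] [NormedAddCommGroup Z] [NormedSpace ℝ Z]
    {F : D × X → Z} {F' : D × X →L[ℝ] Z} {g : D → X} {d₀ : D} {P : Z →L[ℝ] X} {L : D →L[ℝ] X}
    (hg : ContinuousAt g d₀) (hF : HasFDerivAt F F' (d₀, g d₀))
    (h0 : ∀ᶠ d in 𝓝 d₀, F (d, g d) = 0) (hP : ∀ v u, P (F' (v, u)) + L v = u) :
    HasFDerivAt g L d₀ := by
  -- Put Φ(d, x) = (d, F(d, x)). Along the graph of `g` it equals d ↦ (d, 0), and by `hP` its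
  -- derivative has the left inverse (v, w) ↦ (v, P w + L v). Since `g` is given and continuous, a
  -- left inverse is enough.
  have h := HasFDerivAt.of_comp_of_leftInverse (g := fun d => (d, g d))
    (f := fun z : D × X => (z.1, F z)) (h := fun d => (d, (0 : Z)))
    (f' := (ContinuousLinearMap.fst ℝ D X).prod F')
    (h' := (ContinuousLinearMap.id ℝ D).prod 0)
    (f'symm := (ContinuousLinearMap.fst ℝ D Z).prod
      (P ∘L ContinuousLinearMap.snd ℝ D Z + L ∘L ContinuousLinearMap.fst ℝ D Z))
    (a := d₀) (continuousAt_id.prodMk hg) (hasFDerivAt_fst.prodMk hF)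
    ((hasFDerivAt_id d₀).prodMk (hasFDerivAt_const _ _))
    (by filter_upwards [h0] with d hd; simp [hd])
    (by rintro ⟨v, u⟩; simp [hP])
  have h2 := h.snd
  refine h2.congr_fderiv ?_
  ext v
  simp

theorem Continuous.tendsto_apply₂ {α β γ δ : Type*} {l : Filter α} [TopologicalSpace β]
    [TopologicalSpace γ] [TopologicalSpace δ] {f : β → γ → δ}
    (hf : Continuous fun p : β × γ => f p.1 p.2) {u : α → β} {v : α → γ} {u₀ : β} {v₀ : γ}
    (hu : Tendsto u l (𝓝 u₀)) (hv : Tendsto v l (𝓝 v₀)) :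
    Tendsto (fun a => f (u a) (v a)) l (𝓝 (f u₀ v₀)) :=
  (hf.tendsto (u₀, v₀)).comp (hu.prodMk_nhds hv)

/-! ### The smallest singular value as minimal stretching factor, and its continuity -/

namespace LinearMap

variable {E F : Type*} [NormedAddCommGroup E] [InnerProductSpace ℝ E] [FiniteDimensional ℝ E]
  [NormedAddCommGroup F] [InnerProductSpace ℝ F] [FiniteDimensional ℝ F]

/-- The last singular value is a lower bound for the stretching factor of a linear map. -/
theorem singularValues_last_mul_norm_le (T : E →ₗ[ℝ] F) {k : ℕ}
    (hk : Module.finrank ℝ E = k + 1) (v : E) : T.singularValues k * ‖v‖ ≤ ‖T v‖ := by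
  have hT := T.isSymmetric_adjoint_comp_self
  set B := hT.eigenvectorBasis hk
  have hs : ∀ i : Fin (k + 1), T.singularValues k ^ 2 ≤ hT.eigenvalues hk i := by
    intro i
    have := T.sq_singularValues_fin hk (Fin.last k)
    rw [Fin.val_last] at this
    rw [this]
    exact hT.eigenvalues_antitone hk (Fin.le_last i)
  have h1 : ‖T v‖ ^ 2 = ∑ i, hT.eigenvalues hk i * (B.repr v i) ^ 2 := by
    rw [← real_inner_self_eq_norm_sq, ← LinearMap.adjoint_inner_left, ← LinearMap.comp_apply,
      ← B.repr.inner_map_map, PiLp.inner_apply]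
    refine Finset.sum_congr rfl fun i _ => ?_
    rw [hT.eigenvectorBasis_apply_self_apply hk]
    simp [B]; ring
  have h2 : ‖v‖ ^ 2 = ∑ i, (B.repr v i) ^ 2 := by
    rw [← B.repr.norm_map, EuclideanSpace.real_norm_sq_eq]
  refine le_of_sq_le_sq ?_ (norm_nonneg _)
  rw [mul_pow, h1, h2, Finset.mul_sum]
  exact Finset.sum_le_sum fun i _ => mul_le_mul_of_nonneg_right (hs i) (sq_nonneg _)

/-- The last singular value is attained as a stretching factor. -/
theorem exists_norm_eq_singularValues_last (T : E →ₗ[ℝ] F) {k : ℕ}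
    (hk : Module.finrank ℝ E = k + 1) : ∃ v : E, ‖v‖ = 1 ∧ ‖T v‖ = T.singularValues k := by
  have hT := T.isSymmetric_adjoint_comp_self
  refine ⟨hT.eigenvectorBasis hk (Fin.last k), by simp, ?_⟩
  rw [← sq_eq_sq₀ (norm_nonneg _) (T.singularValues_nonneg k)]
  have := T.sq_singularValues_fin hk (Fin.last k)
  rw [Fin.val_last] at this
  rw [this, ← real_inner_self_eq_norm_sq, ← LinearMap.adjoint_inner_left, ← LinearMap.comp_apply,
    hT.apply_eigenvectorBasis hk, real_inner_smul_left, real_inner_self_eq_norm_sq]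
  simp

/-- Weyl's perturbation bound: test `T` on a unit vector that `S` stretches least. -/
theorem singularValues_last_le_add (T S : E →ₗ[ℝ] F) {k : ℕ}
    (hk : Module.finrank ℝ E = k + 1) :
    T.singularValues k ≤ S.singularValues k + ‖(T - S).toContinuousLinearMap‖ := by
  obtain ⟨v, hv, hS⟩ := S.exists_norm_eq_singularValues_last hk
  have h1 := T.singularValues_last_mul_norm_le hk v
  have h2 := (T - S).toContinuousLinearMap.le_opNorm v
  rw [hv, mul_one] at h1 h2
  have h3 : T v = S v + (T - S).toContinuousLinearMap v := by simp
  rw [h3] at h1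
  linarith [norm_add_le (S v) ((T - S).toContinuousLinearMap v)]

/-- The last singular value depends continuously on the linear map. -/
theorem tendsto_singularValues_last {α : Type*} {l : Filter α} {f : α → E →ₗ[ℝ] F}
    {T : E →ₗ[ℝ] F} {k : ℕ} (hk : Module.finrank ℝ E = k + 1)
    (hf : Tendsto (fun a => (f a).toContinuousLinearMap) l (𝓝 T.toContinuousLinearMap)) :
    Tendsto (fun a => (f a).singularValues k) l (𝓝 (T.singularValues k)) := by
  rw [tendsto_iff_norm_sub_tendsto_zero] at hf ⊢
  refine squeeze_zero (fun _ => norm_nonneg _) (fun a => ?_) hf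
  have h1 := (f a).singularValues_last_le_add T hk
  have h2 := T.singularValues_last_le_add (f a) hk
  rw [map_sub] at h1 h2
  rw [norm_sub_rev] at h2
  rw [Real.norm_eq_abs, abs_le]
  constructor <;> linarith

end LinearMap

namespace STLS

section SingularValues

variable {p q : Type*} [Fintype p] [Fintype q] [DecidableEq q]

theorem sv_nonneg (X : Matrix p q ℝ) (k : ℕ) : 0 ≤ sv X k :=
  LinearMap.singularValues_nonneg _ _

theorem sv_mul_norm_le (X : Matrix p q ℝ) {k : ℕ} (hk : Fintype.card q = k + 1)
    (v : EuclideanSpace ℝ q) : sv X k * ‖v‖ ≤ ‖Matrix.toEuclideanLin X v‖ :=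
  LinearMap.singularValues_last_mul_norm_le _ (by simpa using hk) v

theorem exists_norm_eq_sv (X : Matrix p q ℝ) {k : ℕ} (hk : Fintype.card q = k + 1) :
    ∃ v : EuclideanSpace ℝ q, ‖v‖ = 1 ∧ ‖Matrix.toEuclideanLin X v‖ = sv X k :=
  LinearMap.exists_norm_eq_singularValues_last _ (by simpa using hk)

theorem continuous_sv {k : ℕ} (hk : Fintype.card q = k + 1) :
    Continuous fun X : Matrix p q ℝ => sv X k := by
  rw [continuous_iff_continuousAt]
  intro X
  refine LinearMap.tendsto_singularValues_last (by simpa using hk) ?_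
  exact ((Matrix.toEuclideanLin (𝕜 := ℝ) (m := p) (n := q)).trans
    LinearMap.toContinuousLinearMap).toLinearMap.continuous_of_finiteDimensional.tendsto X

end SingularValues

variable {m n : ℕ}

/-! ### Stacked vectors -/

/-- The vector `(y, t)`. -/
noncomputable def joinVec (y : EuclideanSpace ℝ (Fin n)) (t : ℝ) :
    EuclideanSpace ℝ (Fin n ⊕ Unit) :=
  WithLp.toLp 2 (Sum.elim y.ofLp fun _ => t)

theorem exists_eq_joinVec (w : EuclideanSpace ℝ (Fin n ⊕ Unit)) : ∃ y t, w = joinVec y t :=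
  ⟨WithLp.toLp 2 fun i => w (Sum.inl i), w (Sum.inr ()), by
    ext i; rcases i with i | i <;> rfl⟩

theorem norm_sq_joinVec (y : EuclideanSpace ℝ (Fin n)) (t : ℝ) :
    ‖joinVec y t‖ ^ 2 = ‖y‖ ^ 2 + t ^ 2 := by
  simp [EuclideanSpace.real_norm_sq_eq, joinVec]

theorem toEuclideanLin_aug_joinVec (A : Matrix (Fin m) (Fin n) ℝ) (b : EuclideanSpace ℝ (Fin m))
    (y : EuclideanSpace ℝ (Fin n)) (t : ℝ) :
    Matrix.toEuclideanLin (aug A b) (joinVec y t) = Matrix.toEuclideanLin A y + t • b := by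
  ext i
  simp [joinVec, aug, Matrix.mulVec, dotProduct, mul_comm]

theorem toEuclideanLin_mul_apply {p q s : Type*} [Fintype p] [Fintype q] [Fintype s]
    [DecidableEq q] [DecidableEq s] (X : Matrix p q ℝ) (Y : Matrix q s ℝ)
    (v : EuclideanSpace ℝ s) :
    Matrix.toEuclideanLin (X * Y) v = Matrix.toEuclideanLin X (Matrix.toEuclideanLin Y v) := by
  simp [Matrix.toLpLin_apply]

theorem toEuclideanLin_one_apply {p : Type*} [Fintype p] [DecidableEq p]
    (v : EuclideanSpace ℝ p) : Matrix.toEuclideanLin (1 : Matrix p p ℝ) v = v := by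
  simp

theorem inner_toEuclideanLin_transpose {p q : Type*} [Fintype p] [Fintype q] [DecidableEq p]
    [DecidableEq q] (X : Matrix p q ℝ) (u : EuclideanSpace ℝ p) (v : EuclideanSpace ℝ q) :
    inner ℝ (Matrix.toEuclideanLin Xᵀ u) v = inner ℝ u (Matrix.toEuclideanLin X v) := by
  have := Matrix.toEuclideanLin_conjTranspose_eq_adjoint X
  rw [Matrix.conjTranspose_eq_transpose_of_trivial] at this
  rw [this, LinearMap.adjoint_inner_left]

theorem toEuclideanLin_gramShift (A : Matrix (Fin m) (Fin n) ℝ) (s : ℝ)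
    (x : EuclideanSpace ℝ (Fin n)) :
    Matrix.toEuclideanLin (gramShift A s) x
      = Matrix.toEuclideanLin Aᵀ (Matrix.toEuclideanLin A x) - s ^ 2 • x := by
  rw [gramShift, map_sub, map_smul, LinearMap.sub_apply, LinearMap.smul_apply,
    toEuclideanLin_mul_apply, toEuclideanLin_one_apply]

theorem gramShift_transpose (A : Matrix (Fin m) (Fin n) ℝ) (s : ℝ) :
    (gramShift A s)ᵀ = gramShift A s := by
  simp [gramShift]

/-! ### The Frobenius norm -/

theorem frob_nonneg (E : Matrix (Fin m) (Fin n) ℝ) (r : EuclideanSpace ℝ (Fin m)) :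
    0 ≤ frob E r := Real.sqrt_nonneg _

/-- Cauchy–Schwarz in each row. -/
theorem norm_aug_le (E : Matrix (Fin m) (Fin n) ℝ) (r : EuclideanSpace ℝ (Fin m))
    (w : EuclideanSpace ℝ (Fin n ⊕ Unit)) :
    ‖Matrix.toEuclideanLin (aug E r) w‖ ≤ frob E r * ‖w‖ := by
  refine le_of_sq_le_sq ?_ (mul_nonneg (frob_nonneg _ _) (norm_nonneg _))
  rw [mul_pow, frob, Real.sq_sqrt (by positivity), EuclideanSpace.real_norm_sq_eq,
    EuclideanSpace.real_norm_sq_eq, Finset.sum_mul]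
  refine Finset.sum_le_sum fun i _ => ?_
  exact Finset.sum_mul_sq_le_sq_mul_sq Finset.univ (fun j => aug E r i j) fun j => w j

/-- The rank one correction that makes `y` satisfy `(A + E) y = b - r`. -/
theorem exists_correction (A : Matrix (Fin m) (Fin n) ℝ) (b : EuclideanSpace ℝ (Fin m))
    (y : EuclideanSpace ℝ (Fin n)) :
    ∃ E r, Matrix.toEuclideanLin (A + E) y = b - r ∧
      frob E r ^ 2 * (1 + ‖y‖ ^ 2) = ‖resid A b y‖ ^ 2 := by
  have hN : (0 : ℝ) < 1 + ‖y‖ ^ 2 := by positivity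
  set N := 1 + ‖y‖ ^ 2 with hNdef
  set u := resid A b y with hu
  -- This is [E r] = -(1/N) u [yᵀ 1], the equality case of `norm_aug_le` at (y, 1): it sends (y, 1)
  -- to -u because N = ‖(y, 1)‖².
  refine ⟨-(1 / N) • Matrix.vecMulVec u.ofLp y.ofLp, -(1 / N) • u, ?_, ?_⟩
  · have hE : Matrix.toEuclideanLin (Matrix.vecMulVec u.ofLp y.ofLp) y = ‖y‖ ^ 2 • u := by
      ext i
      simp only [Matrix.toLpLin_apply, Matrix.mulVec, dotProduct, Matrix.vecMulVec_apply,
        EuclideanSpace.real_norm_sq_eq, PiLp.smul_apply, smul_eq_mul, Finset.sum_mul]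
      exact Finset.sum_congr rfl fun j _ => by ring
    have hA : Matrix.toEuclideanLin A y = u + b := by simp [hu, resid]
    rw [map_add, map_smul, LinearMap.add_apply, LinearMap.smul_apply, hE, hA]
    have : (-(1 / N)) • ‖y‖ ^ 2 • u = -u + (1 / N) • u := by
      rw [smul_smul]
      have : -(1 / N) * ‖y‖ ^ 2 = -1 + 1 / N := by
        field_simp
        rw [hNdef]; ring
      rw [this, add_smul, neg_one_smul]
    rw [this]
    module
  · rw [frob, Real.sq_sqrt (by positivity)]
    have : ∑ i, ∑ j, aug (-(1 / N) • Matrix.vecMulVec u.ofLp y.ofLp) (-(1 / N) • u) i j ^ 2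
        = ∑ i, (1 / N) ^ 2 * u i ^ 2 * N := by
      refine Finset.sum_congr rfl fun i _ => ?_
      simp only [aug, Fintype.sum_sum_type, Matrix.fromCols_apply_inl, Matrix.fromCols_apply_inr,
        Matrix.replicateCol_apply, Matrix.smul_apply, Matrix.vecMulVec_apply, smul_eq_mul,
        Finset.univ_unique, Finset.sum_singleton, PiLp.smul_apply, mul_pow,
        ← Finset.mul_sum, ← EuclideanSpace.real_norm_sq_eq, neg_sq]
      rw [hNdef]; ring
    rw [this, ← Finset.sum_mul, ← Finset.mul_sum, ← EuclideanSpace.real_norm_sq_eq]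
    field_simp

/-! ### Total least squares under the gap condition -/

/-- The vector (y, -1) is sent to the residual by [A b] and has squared norm 1 + ‖y‖². -/
theorem sq_mul_le_resid (A : Matrix (Fin m) (Fin n) ℝ) (b : EuclideanSpace ℝ (Fin m))
    (y : EuclideanSpace ℝ (Fin n)) : sv (aug A b) n ^ 2 * (1 + ‖y‖ ^ 2) ≤ ‖resid A b y‖ ^ 2 := by
  have h := sv_mul_norm_le (aug A b) (k := n) (by simp) (joinVec y (-1))
  have h2 := pow_le_pow_left₀ (mul_nonneg (sv_nonneg _ _) (norm_nonneg _)) h 2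
  rw [mul_pow, norm_sq_joinVec, toEuclideanLin_aug_joinVec] at h2
  rw [resid, sub_eq_add_neg]
  simpa [add_comm] using h2

/-- Take a unit vector (w, t) that [A b] stretches least. If t = 0, then w is a unit vector with
‖Aw‖ = σ_{n+1}, below the smallest singular value of A, against the gap. So t ≠ 0, and rescaling the
last entry to -1 gives `y`. -/
theorem exists_resid_eq (hn : 0 < n) (A : Matrix (Fin m) (Fin n) ℝ)
    (b : EuclideanSpace ℝ (Fin m)) (hgap : sv (aug A b) n < sv A (n - 1)) :
    ∃ y, ‖resid A b y‖ ^ 2 = sv (aug A b) n ^ 2 * (1 + ‖y‖ ^ 2) := by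
  obtain ⟨w, hw, hws⟩ := exists_norm_eq_sv (aug A b) (k := n) (by simp)
  obtain ⟨y, t, rfl⟩ := exists_eq_joinVec w
  rw [toEuclideanLin_aug_joinVec] at hws
  have hw2 := norm_sq_joinVec y t
  rw [hw] at hw2
  have ht : t ≠ 0 := by
    rintro rfl
    have hy : ‖y‖ = 1 := by
      have : ‖y‖ ^ 2 = 1 := by linarith
      nlinarith [norm_nonneg y]
    have := sv_mul_norm_le A (k := n - 1) (by simp; omega) y
    rw [hy] at this
    simp at hws
    linarith
  refine ⟨(-t⁻¹) • y, ?_⟩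
  have h1 : resid A b ((-t⁻¹) • y) = (-t⁻¹) • (Matrix.toEuclideanLin A y + t • b) := by
    rw [resid, map_smul, smul_add, smul_smul, neg_mul, inv_mul_cancel₀ ht]
    module
  rw [h1, norm_smul, hws, norm_smul, mul_pow, mul_pow]
  have : ‖-t⁻¹‖ ^ 2 = (t ^ 2)⁻¹ := by simp
  rw [this]
  have : ‖y‖ ^ 2 = 1 - t ^ 2 := by linarith
  rw [this]
  field_simp
  ring

/-- By `hlow` and `exists_correction`, the cheapest correction admitting `z` costs exactly ‖Az - b‖²
/ (1 + ‖z‖²). The minimisers are therefore the points where this quotient reaches its least value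
σ_{n+1}². -/
theorem isTLSSolution_iff_resid_le (hn : 0 < n) (A : Matrix (Fin m) (Fin n) ℝ)
    (b : EuclideanSpace ℝ (Fin m)) (hgap : sv (aug A b) n < sv A (n - 1))
    (y : EuclideanSpace ℝ (Fin n)) :
    IsTLSSolution A b y ↔ ‖resid A b y‖ ^ 2 = sv (aug A b) n ^ 2 * (1 + ‖y‖ ^ 2) := by
  have hlow : ∀ E r z, Matrix.toEuclideanLin (A + E) z = b - r →
      ‖resid A b z‖ ^ 2 ≤ frob E r ^ 2 * (1 + ‖z‖ ^ 2) := by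
    intro E r z h
    have h1 := pow_le_pow_left₀ (norm_nonneg _) (norm_aug_le E r (joinVec z 1)) 2
    rw [mul_pow, norm_sq_joinVec, toEuclideanLin_aug_joinVec] at h1
    have h2 : resid A b z = -(Matrix.toEuclideanLin E z + (1 : ℝ) • r) := by
      rw [map_add, LinearMap.add_apply] at h
      rw [resid, eq_sub_of_add_eq h]
      module
    rw [h2, norm_neg]
    simpa [add_comm] using h1
  have hpos : ∀ z : EuclideanSpace ℝ (Fin n), (0 : ℝ) < 1 + ‖z‖ ^ 2 := fun z => by positivity
  constructor
  · rintro ⟨E, r, -, hmin, hy⟩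
    refine le_antisymm ?_ (sq_mul_le_resid A b y)
    obtain ⟨y0, hy0⟩ := exists_resid_eq hn A b hgap
    obtain ⟨E0, r0, hf, he⟩ := exists_correction A b y0
    rw [hy0] at he
    have he := mul_right_cancel₀ (hpos y0).ne' he
    have h1 := hmin E0 r0 ⟨y0, hf⟩
    have h2 := pow_le_pow_left₀ (frob_nonneg _ _) h1 2
    rw [he] at h2
    exact (hlow E r y hy).trans (mul_le_mul_of_nonneg_right h2 (hpos y).le)
  · intro hy
    obtain ⟨E, r, hf, he⟩ := exists_correction A b y
    rw [hy] at he
    have he := mul_right_cancel₀ (hpos y).ne' he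
    refine ⟨E, r, ⟨y, hf⟩, ?_, hf⟩
    rintro E' r' ⟨z, hz⟩
    refine le_of_sq_le_sq ?_ (frob_nonneg _ _)
    rw [he]
    exact le_of_mul_le_mul_right ((sq_mul_le_resid A b z).trans (hlow E' r' z hz)) (hpos z)

theorem eq_zero_of_forall_quadratic_nonneg {a c : ℝ} (h : ∀ t : ℝ, 0 ≤ 2 * t * a + t ^ 2 * c) :
    a = 0 := by
  have := discrim_le_zero (a := c) (b := 2 * a) (c := 0) fun t => by linarith [h t]
  rw [discrim] at this
  nlinarith [sq_nonneg a]

/-- The function ‖Az - b‖² - s²(1 + ‖z‖²) is nonnegative and vanishes at `y`. On each line through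
`y` it is quadratic, so its linear coefficient there must be zero. -/
theorem transpose_resid_eq_of_resid_eq (A : Matrix (Fin m) (Fin n) ℝ)
    (b : EuclideanSpace ℝ (Fin m)) {s : ℝ}
    (hs : ∀ z, s ^ 2 * (1 + ‖z‖ ^ 2) ≤ ‖resid A b z‖ ^ 2) {y : EuclideanSpace ℝ (Fin n)}
    (hy : ‖resid A b y‖ ^ 2 = s ^ 2 * (1 + ‖y‖ ^ 2)) :
    Matrix.toEuclideanLin Aᵀ (resid A b y) = s ^ 2 • y := by
  refine ext_inner_right ℝ fun z => ?_
  rw [inner_toEuclideanLin_transpose, real_inner_smul_left, ← sub_eq_zero]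
  refine eq_zero_of_forall_quadratic_nonneg
    (c := ‖Matrix.toEuclideanLin A z‖ ^ 2 - s ^ 2 * ‖z‖ ^ 2) fun t => ?_
  have h := hs (y + t • z)
  have h1 : resid A b (y + t • z) = resid A b y + t • Matrix.toEuclideanLin A z := by
    simp only [resid, map_add, map_smul]
    module
  rw [h1, norm_add_sq_real, norm_add_sq_real, hy, norm_smul, norm_smul, real_inner_smul_right,
    real_inner_smul_right, mul_pow, mul_pow, Real.norm_eq_abs, sq_abs] at h
  linarith

theorem isUnit_det_of_injective {M : Matrix (Fin n) (Fin n) ℝ}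
    (h : ∀ z, Matrix.toEuclideanLin M z = 0 → z = 0) : IsUnit M.det := by
  rw [← Matrix.isUnit_iff_isUnit_det, ← Matrix.mulVec_injective_iff_isUnit]
  refine (injective_iff_map_eq_zero (Matrix.mulVecLin M)).2 fun z hz => ?_
  have := h (WithLp.toLp 2 z) (by simpa [Matrix.toLpLin_apply] using hz)
  simpa using this

/-- A kernel vector z would satisfy ‖Az‖² = s²‖z‖², whereas ‖Az‖ is at least the smallest singular
value of A times ‖z‖. -/
theorem isUnit_det_gramShift (hn : 0 < n) (A : Matrix (Fin m) (Fin n) ℝ) {s : ℝ} (hs0 : 0 ≤ s)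
    (hs : s < sv A (n - 1)) : IsUnit (gramShift A s).det := by
  refine isUnit_det_of_injective fun z hz => ?_
  by_contra hz0
  rw [toEuclideanLin_gramShift] at hz
  have h1 := congrArg (fun u => inner ℝ u z) hz
  simp only [inner_sub_left, inner_toEuclideanLin_transpose, real_inner_smul_left,
    real_inner_self_eq_norm_sq, inner_zero_left] at h1
  have h2 := sv_mul_norm_le A (k := n - 1) (by simp; omega) z
  have h3 : s * ‖z‖ < ‖Matrix.toEuclideanLin A z‖ :=
    (mul_lt_mul_of_pos_right hs (norm_pos_iff.2 hz0)).trans_le h2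
  have h4 := pow_lt_pow_left₀ h3 (by positivity) two_ne_zero
  rw [mul_pow] at h4
  linarith

theorem eq_inv_apply_iff {M : Matrix (Fin n) (Fin n) ℝ} (hM : IsUnit M.det)
    (x u : EuclideanSpace ℝ (Fin n)) :
    x = Matrix.toEuclideanLin M⁻¹ u ↔ Matrix.toEuclideanLin M x = u := by
  constructor
  · rintro rfl
    rw [← toEuclideanLin_mul_apply, Matrix.mul_nonsing_inv _ hM, toEuclideanLin_one_apply]
  · rintro rfl
    rw [← toEuclideanLin_mul_apply, Matrix.nonsing_inv_mul _ hM, toEuclideanLin_one_apply]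

theorem eq_of_isTLSSolution (hn : 0 < n) (A : Matrix (Fin m) (Fin n) ℝ)
    (b : EuclideanSpace ℝ (Fin m)) (hgap : sv (aug A b) n < sv A (n - 1))
    {y : EuclideanSpace ℝ (Fin n)} (hy : IsTLSSolution A b y) :
    y = Matrix.toEuclideanLin ((tlsM A b)⁻¹ * Aᵀ) b := by
  rw [toEuclideanLin_mul_apply,
    eq_inv_apply_iff (M := tlsM A b) (isUnit_det_gramShift hn A (sv_nonneg _ _) hgap), tlsM,
    toEuclideanLin_gramShift, ← transpose_resid_eq_of_resid_eq A b (sq_mul_le_resid A b)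
      ((isTLSSolution_iff_resid_le hn A b hgap y).1 hy), resid, map_sub]
  abel

/-- Under the gap condition the total least squares problem has exactly one solution. -/
theorem isTLSSolution_iff (hn : 0 < n) (A : Matrix (Fin m) (Fin n) ℝ)
    (b : EuclideanSpace ℝ (Fin m)) (hgap : sv (aug A b) n < sv A (n - 1))
    (y : EuclideanSpace ℝ (Fin n)) :
    IsTLSSolution A b y ↔ y = Matrix.toEuclideanLin ((tlsM A b)⁻¹ * Aᵀ) b := by
  refine ⟨eq_of_isTLSSolution hn A b hgap, ?_⟩
  rintro rfl
  -- A solution exists and every solution is given by the formula, so the formula gives a solution.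
  obtain ⟨y, hy⟩ := exists_resid_eq hn A b hgap
  rw [← isTLSSolution_iff_resid_le hn A b hgap] at hy
  rwa [← eq_of_isTLSSolution hn A b hgap hy]

/-! ### Scaled total least squares under the gap condition -/

theorem isSTLSSolution_iff_isTLSSolution (lam : ℝ) (A : Matrix (Fin m) (Fin n) ℝ)
    (b : EuclideanSpace ℝ (Fin m)) (x : EuclideanSpace ℝ (Fin n)) :
    IsSTLSSolution lam A b x ↔ IsTLSSolution A (lam • b) (lam • x) := Iff.rfl

/-- `stlsM lam A b` is by definition `tlsM A (lam • b)`, and the TLS formula is linear in the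
right-hand side for fixed M, so the factor `lam` cancels. -/
theorem isSTLSSolution_iff (hn : 0 < n) {lam : ℝ} (hlam : lam ≠ 0)
    (A : Matrix (Fin m) (Fin n) ℝ) (b : EuclideanSpace ℝ (Fin m))
    (hgap : sv (aug A (lam • b)) n < sv A (n - 1)) (x : EuclideanSpace ℝ (Fin n)) :
    IsSTLSSolution lam A b x ↔ x = Matrix.toEuclideanLin ((stlsM lam A b)⁻¹ * Aᵀ) b := by
  rw [isSTLSSolution_iff_isTLSSolution, isTLSSolution_iff hn A (lam • b) hgap, map_smul]
  exact smul_right_inj hlam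

theorem existsUnique_isSTLSSolution (hn : 0 < n) {lam : ℝ} (hlam : lam ≠ 0)
    (A : Matrix (Fin m) (Fin n) ℝ) (b : EuclideanSpace ℝ (Fin m))
    (hgap : sv (aug A (lam • b)) n < sv A (n - 1)) : ∃! x, IsSTLSSolution lam A b x := by
  simp [isSTLSSolution_iff hn hlam A b hgap]

theorem isSTLSSolution_stlsSol (hn : 0 < n) {lam : ℝ} (hlam : lam ≠ 0)
    (A : Matrix (Fin m) (Fin n) ℝ) (b : EuclideanSpace ℝ (Fin m))
    (hgap : sv (aug A (lam • b)) n < sv A (n - 1)) : IsSTLSSolution lam A b (stlsSol lam A b) :=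
  Classical.epsilon_spec (existsUnique_isSTLSSolution hn hlam A b hgap).exists

theorem stlsSol_eq (hn : 0 < n) {lam : ℝ} (hlam : lam ≠ 0)
    (A : Matrix (Fin m) (Fin n) ℝ) (b : EuclideanSpace ℝ (Fin m))
    (hgap : sv (aug A (lam • b)) n < sv A (n - 1)) :
    stlsSol lam A b = Matrix.toEuclideanLin ((stlsM lam A b)⁻¹ * Aᵀ) b :=
  (isSTLSSolution_iff hn hlam A b hgap _).1 (isSTLSSolution_stlsSol hn hlam A b hgap)

theorem resid_smul (lam : ℝ) (A : Matrix (Fin m) (Fin n) ℝ) (b : EuclideanSpace ℝ (Fin m))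
    (x : EuclideanSpace ℝ (Fin n)) : resid A (lam • b) (lam • x) = lam • resid A b x := by
  rw [resid, resid, map_smul, smul_sub]

/-- The attained Rayleigh quotient at `lam • x`. Eliminating σ² between this and `transpose_stlsRes`
yields the equation `normalFun (lam ^ 2) = 0`. -/
theorem sq_mul_norm_sq_stlsRes (hn : 0 < n) {lam : ℝ} (hlam : lam ≠ 0)
    (A : Matrix (Fin m) (Fin n) ℝ) (b : EuclideanSpace ℝ (Fin m))
    (hgap : sv (aug A (lam • b)) n < sv A (n - 1)) :
    lam ^ 2 * ‖stlsRes lam A b‖ ^ 2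
      = sv (aug A (lam • b)) n ^ 2 * (1 + lam ^ 2 * ‖stlsSol lam A b‖ ^ 2) := by
  have h := (isTLSSolution_iff_resid_le hn A (lam • b) hgap _).1
    (isSTLSSolution_stlsSol hn hlam A b hgap)
  rw [resid_smul, norm_smul, norm_smul, mul_pow, mul_pow, Real.norm_eq_abs, sq_abs] at h
  exact h

theorem transpose_stlsRes (hn : 0 < n) {lam : ℝ} (hlam : lam ≠ 0)
    (A : Matrix (Fin m) (Fin n) ℝ) (b : EuclideanSpace ℝ (Fin m))
    (hgap : sv (aug A (lam • b)) n < sv A (n - 1)) :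
    Matrix.toEuclideanLin Aᵀ (stlsRes lam A b)
      = sv (aug A (lam • b)) n ^ 2 • stlsSol lam A b := by
  have h := transpose_resid_eq_of_resid_eq A (lam • b) (sq_mul_le_resid A (lam • b))
    ((isTLSSolution_iff_resid_le hn A (lam • b) hgap _).1
      (isSTLSSolution_stlsSol hn hlam A b hgap))
  rw [resid_smul, map_smul, smul_comm] at h
  exact (smul_right_inj hlam).1 h

/-! ### Spectral norms -/

section

open scoped Matrix.Norms.L2Operator

/-- The C*-identity for the transpose. It allows matrices with different numbers of columns to be
compared through their products X Xᵀ. -/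
theorem specNorm_eq_sqrt {p q : Type*} [Fintype p] [Fintype q] [DecidableEq p] [DecidableEq q]
    (X : Matrix p q ℝ) : specNorm X = Real.sqrt (specNorm (X * Xᵀ)) := by
  have h1 := Matrix.l2_opNorm_conjTranspose_mul_self Xᴴ
  rw [Matrix.conjTranspose_conjTranspose, Matrix.l2_opNorm_conjTranspose,
    Matrix.conjTranspose_eq_transpose_of_trivial] at h1
  change ‖X‖ = Real.sqrt ‖X * Xᵀ‖
  rw [h1, Real.sqrt_mul_self (norm_nonneg X)]

end

theorem continuous_specNorm {p q : Type*} [Fintype p] [Fintype q] [DecidableEq q] :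
    Continuous fun X : Matrix p q ℝ => specNorm X :=
  continuous_norm.comp ((Matrix.toEuclideanLin (𝕜 := ℝ) (m := p) (n := q)).trans
    LinearMap.toContinuousLinearMap).toLinearMap.continuous_of_finiteDimensional

/-! ### The Kronecker blocks -/

theorem kronX_inl (x : EuclideanSpace ℝ (Fin n)) (i i' : Fin m) (j : Fin n) :
    kronX m x i (Sum.inl j, i') = x j * (1 : Matrix (Fin m) (Fin m) ℝ) i i' := by
  simp [kronX]

theorem kronX_inr (x : EuclideanSpace ℝ (Fin n)) (i i' : Fin m) (u : Unit) :
    kronX m x i (Sum.inr u, i') = -(1 : Matrix (Fin m) (Fin m) ℝ) i i' := by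
  simp [kronX]

theorem kronR_inl (r : EuclideanSpace ℝ (Fin m)) (i : Fin m) (k j : Fin n) :
    kronR n r k (Sum.inl j, i) = (1 : Matrix (Fin n) (Fin n) ℝ) k j * r i := by
  simp [kronR]

theorem kronR_inr (r : EuclideanSpace ℝ (Fin m)) (i : Fin m) (k : Fin n) (u : Unit) :
    kronR n r k (Sum.inr u, i) = 0 := by
  simp [kronR]

/-- This and the next two products are all that K Kᵀ requires from the Kronecker blocks. -/
theorem kronX_mul_transpose (x : EuclideanSpace ℝ (Fin n)) :
    kronX m x * (kronX m x)ᵀ = (1 + ‖x‖ ^ 2) • 1 := by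
  ext i k
  simp only [Matrix.mul_apply, Matrix.transpose_apply, Fintype.sum_prod_type,
    Fintype.sum_sum_type, kronX_inl, kronX_inr, Matrix.one_apply, Matrix.smul_apply,
    EuclideanSpace.real_norm_sq_eq]
  by_cases h : i = k
  · subst h
    simp [← sq, add_comm]
  · simp [h]

theorem kronX_mul_kronR_transpose (x : EuclideanSpace ℝ (Fin n)) (r : EuclideanSpace ℝ (Fin m)) :
    kronX m x * (kronR n r)ᵀ = Matrix.vecMulVec r.ofLp x.ofLp := by
  ext i k
  simp [Matrix.mul_apply, Fintype.sum_prod_type, kronX_inl, kronX_inr, kronR_inl,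
    kronR_inr, Matrix.one_apply, Matrix.vecMulVec_apply, mul_comm]

theorem kronR_mul_transpose (r : EuclideanSpace ℝ (Fin m)) :
    kronR n r * (kronR n r)ᵀ = ‖r‖ ^ 2 • 1 := by
  ext i k
  simp only [Matrix.mul_apply, Matrix.transpose_apply, Fintype.sum_prod_type,
    Fintype.sum_sum_type, kronR_inl, kronR_inr, Matrix.one_apply, Matrix.smul_apply,
    EuclideanSpace.real_norm_sq_eq]
  by_cases h : i = k
  · subst h
    simp [← sq]
  · simp [h]

/-- The identity (xᵀ ⊗ I) vec E = E x, which translates between the Kronecker form of K and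
directional derivatives. -/
theorem toEuclideanLin_kronX (x : EuclideanSpace ℝ (Fin n)) (d : Data m n) :
    Matrix.toEuclideanLin (kronX m x) d = resid (dataMat d) (dataRhs d) x := by
  ext i
  simp [Matrix.toLpLin_apply, Matrix.mulVec, dotProduct, Fintype.sum_prod_type, kronX_inl,
    kronX_inr, Matrix.one_apply, resid, dataMat, dataRhs, mul_comm, sub_eq_add_neg]

theorem toEuclideanLin_kronR (r : EuclideanSpace ℝ (Fin m)) (d : Data m n) :
    Matrix.toEuclideanLin (kronR n r) d = Matrix.toEuclideanLin (dataMat d)ᵀ r := by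
  ext k
  simp [Matrix.toLpLin_apply, Matrix.mulVec, dotProduct, Fintype.sum_prod_type, kronR_inl,
    kronR_inr, Matrix.one_apply, dataMat, mul_comm]

theorem vecMulVec_mul_vecMulVec_ofLp {p s : Type*} (u : p → ℝ) (r : EuclideanSpace ℝ (Fin m))
    (v : s → ℝ) : Matrix.vecMulVec u r.ofLp * Matrix.vecMulVec r.ofLp v
      = ‖r‖ ^ 2 • Matrix.vecMulVec u v := by
  ext i j
  simp only [Matrix.mul_apply, Matrix.vecMulVec_apply, Matrix.smul_apply, smul_eq_mul,
    EuclideanSpace.real_norm_sq_eq, Finset.sum_mul]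
  exact Finset.sum_congr rfl fun k _ => by ring

/-! ### The three expressions of the condition number agree -/

/-- The symmetric matrix between the two factors `M⁻¹` in `form1`. -/
noncomputable def form1Core (A : Matrix (Fin m) (Fin n) ℝ) (x : EuclideanSpace ℝ (Fin n))
    (r : EuclideanSpace ℝ (Fin m)) : Matrix (Fin n) (Fin n) ℝ :=
  (1 + ‖x‖ ^ 2) • (Aᵀ * A) - Aᵀ * Matrix.vecMulVec r.ofLp x.ofLp
    - Matrix.vecMulVec x.ofLp r.ofLp * A + ‖r‖ ^ 2 • 1

theorem vecMulVec_self_eq_zero {r : EuclideanSpace ℝ (Fin m)} (h : ‖r‖ ^ 2 = 0) :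
    Matrix.vecMulVec r.ofLp r.ofLp = 0 := by
  have : r = 0 := by simpa using h
  simp [this]

/-- For r ≠ 0 the matrix is the reflection in the line spanned by r. For r = 0 the coefficient 2/0
is 0 and the matrix is -I, again orthogonal. -/
theorem reflection_mul_transpose (r : EuclideanSpace ℝ (Fin m)) :
    ((2 / ‖r‖ ^ 2) • Matrix.vecMulVec r.ofLp r.ofLp - 1)
      * ((2 / ‖r‖ ^ 2) • Matrix.vecMulVec r.ofLp r.ofLp - 1)ᵀ = 1 := by
  rw [Matrix.transpose_sub, Matrix.transpose_smul, Matrix.transpose_vecMulVec,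
    Matrix.transpose_one, Matrix.sub_mul, Matrix.mul_sub, Matrix.mul_sub, Matrix.smul_mul,
    Matrix.mul_smul, vecMulVec_mul_vecMulVec_ofLp, Matrix.mul_one, Matrix.mul_one, Matrix.one_mul]
  by_cases h : ‖r‖ ^ 2 = 0
  · simp [vecMulVec_self_eq_zero h]
  · have : (2 / ‖r‖ ^ 2) • (2 / ‖r‖ ^ 2) • ‖r‖ ^ 2 • Matrix.vecMulVec r.ofLp r.ofLp
        = (2 * (2 / ‖r‖ ^ 2)) • Matrix.vecMulVec r.ofLp r.ofLp := by
      rw [smul_smul, smul_smul]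
      congr 1
      field_simp
    rw [this]
    module

theorem reflection_mul_vecMulVec (r : EuclideanSpace ℝ (Fin m)) (v : Fin n → ℝ) :
    ((2 / ‖r‖ ^ 2) • Matrix.vecMulVec r.ofLp r.ofLp - 1) * Matrix.vecMulVec r.ofLp v
      = Matrix.vecMulVec r.ofLp v := by
  rw [Matrix.sub_mul, Matrix.smul_mul, vecMulVec_mul_vecMulVec_ofLp, Matrix.one_mul, smul_smul]
  by_cases h : ‖r‖ ^ 2 = 0
  · have : r = 0 := by simpa using h
    simp [this]
  · rw [div_mul_cancel₀ _ h]
    module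

/-- The first factor is AᵀH with H the reflection above. Orthogonality of H removes it from the
square term, and Hr = r removes it from the mixed terms. -/
theorem matK_core_mul_transpose (A : Matrix (Fin m) (Fin n) ℝ) (x : EuclideanSpace ℝ (Fin n))
    (r : EuclideanSpace ℝ (Fin m)) :
    (((2 / ‖r‖ ^ 2) • (Aᵀ * Matrix.vecMulVec r.ofLp r.ofLp) - Aᵀ) * kronX m x - kronR n r)
      * (((2 / ‖r‖ ^ 2) • (Aᵀ * Matrix.vecMulVec r.ofLp r.ofLp) - Aᵀ) * kronX m x - kronR n r)ᵀ
      = form1Core A x r := by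
  set H := (2 / ‖r‖ ^ 2) • Matrix.vecMulVec r.ofLp r.ofLp - 1 with hH
  have hG : (2 / ‖r‖ ^ 2) • (Aᵀ * Matrix.vecMulVec r.ofLp r.ofLp) - Aᵀ = Aᵀ * H := by
    rw [hH, Matrix.mul_sub, Matrix.mul_smul, Matrix.mul_one]
  have hXR : Aᵀ * H * kronX m x * (kronR n r)ᵀ = Aᵀ * Matrix.vecMulVec r.ofLp x.ofLp := by
    rw [Matrix.mul_assoc, kronX_mul_kronR_transpose, Matrix.mul_assoc, reflection_mul_vecMulVec]
  have hRX : kronR n r * (Aᵀ * H * kronX m x)ᵀ = Matrix.vecMulVec x.ofLp r.ofLp * A := by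
    rw [← Matrix.transpose_transpose (kronR n r), ← Matrix.transpose_mul, hXR,
      Matrix.transpose_mul, Matrix.transpose_transpose, Matrix.transpose_vecMulVec]
  have hXX : Aᵀ * H * kronX m x * (Aᵀ * H * kronX m x)ᵀ = (1 + ‖x‖ ^ 2) • (Aᵀ * A) := by
    rw [Matrix.transpose_mul, Matrix.mul_assoc, ← Matrix.mul_assoc (kronX m x),
      kronX_mul_transpose, Matrix.smul_mul, Matrix.one_mul, Matrix.mul_smul,
      Matrix.transpose_mul, Matrix.mul_assoc, ← Matrix.mul_assoc H, reflection_mul_transpose,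
      Matrix.one_mul, Matrix.transpose_transpose]
  clear_value H
  rw [hG, Matrix.transpose_sub, Matrix.sub_mul, Matrix.mul_sub, Matrix.mul_sub, hXX, hXR, hRX,
    kronR_mul_transpose, form1Core]
  abel

theorem specNorm_matK {M : Matrix (Fin n) (Fin n) ℝ} (hM : Mᵀ = M) (A : Matrix (Fin m) (Fin n) ℝ)
    (x : EuclideanSpace ℝ (Fin n)) (r : EuclideanSpace ℝ (Fin m)) :
    specNorm (matK M A x r) = form1 M A x r := by
  rw [specNorm_eq_sqrt, matK, Matrix.transpose_mul, Matrix.transpose_nonsing_inv, hM,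
    Matrix.mul_assoc, ← Matrix.mul_assoc _ _ M⁻¹, matK_core_mul_transpose, ← Matrix.mul_assoc]
  rfl

/-- The second block contributes -(‖x‖²/‖r‖²) AᵀrrᵀA, since I - rrᵀ/‖r‖² is a symmetric idempotent;
the square term of the third block contributes the same with opposite sign. -/
theorem form2_core_mul_transpose (A : Matrix (Fin m) (Fin n) ℝ) (x : EuclideanSpace ℝ (Fin n))
    (r : EuclideanSpace ℝ (Fin m)) :
    Aᵀ * A + ((‖x‖ • (Aᵀ * (1 - (1 / ‖r‖ ^ 2) • Matrix.vecMulVec r.ofLp r.ofLp)))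
        * (‖x‖ • (Aᵀ * (1 - (1 / ‖r‖ ^ 2) • Matrix.vecMulVec r.ofLp r.ofLp)))ᵀ
      + (‖r‖ • (1 - (1 / ‖r‖ ^ 2) • (Aᵀ * Matrix.vecMulVec r.ofLp x.ofLp)))
        * (‖r‖ • (1 - (1 / ‖r‖ ^ 2) • (Aᵀ * Matrix.vecMulVec r.ofLp x.ofLp)))ᵀ)
      = form1Core A x r := by
  have hP : Aᵀ * (1 - (1 / ‖r‖ ^ 2) • Matrix.vecMulVec r.ofLp r.ofLp)
        * (Aᵀ * (1 - (1 / ‖r‖ ^ 2) • Matrix.vecMulVec r.ofLp r.ofLp))ᵀ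
      = Aᵀ * A - (1 / ‖r‖ ^ 2) • (Aᵀ * Matrix.vecMulVec r.ofLp r.ofLp * A) := by
    have : (1 - (1 / ‖r‖ ^ 2) • Matrix.vecMulVec r.ofLp r.ofLp)
        * (1 - (1 / ‖r‖ ^ 2) • Matrix.vecMulVec r.ofLp r.ofLp)ᵀ
        = 1 - (1 / ‖r‖ ^ 2) • Matrix.vecMulVec r.ofLp r.ofLp := by
      rw [Matrix.transpose_sub, Matrix.transpose_smul, Matrix.transpose_vecMulVec,
        Matrix.transpose_one, Matrix.sub_mul, Matrix.mul_sub, Matrix.mul_sub]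
      simp only [Matrix.smul_mul, Matrix.mul_smul, vecMulVec_mul_vecMulVec_ofLp, Matrix.mul_one,
        Matrix.one_mul]
      by_cases h : ‖r‖ ^ 2 = 0
      · simp [vecMulVec_self_eq_zero h]
      · rw [smul_smul (1 / ‖r‖ ^ 2) (‖r‖ ^ 2), one_div_mul_cancel h]
        module
    rw [Matrix.transpose_mul, Matrix.mul_assoc, ← Matrix.mul_assoc _ _ Aᵀᵀ, this,
      Matrix.transpose_transpose, Matrix.sub_mul, Matrix.one_mul, Matrix.mul_sub,
      Matrix.smul_mul, Matrix.mul_smul, Matrix.mul_assoc]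
  have hQ : Aᵀ * Matrix.vecMulVec r.ofLp x.ofLp * (Aᵀ * Matrix.vecMulVec r.ofLp x.ofLp)ᵀ
      = ‖x‖ ^ 2 • (Aᵀ * Matrix.vecMulVec r.ofLp r.ofLp * A) := by
    rw [Matrix.transpose_mul, Matrix.transpose_vecMulVec, Matrix.mul_assoc,
      ← Matrix.mul_assoc _ _ Aᵀᵀ, vecMulVec_mul_vecMulVec_ofLp, Matrix.smul_mul,
      Matrix.mul_smul, Matrix.transpose_transpose, Matrix.mul_assoc]
  have hT : (Aᵀ * Matrix.vecMulVec r.ofLp x.ofLp)ᵀ = Matrix.vecMulVec x.ofLp r.ofLp * A := by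
    rw [Matrix.transpose_mul, Matrix.transpose_vecMulVec, Matrix.transpose_transpose]
  rw [Matrix.transpose_smul, Matrix.smul_mul, Matrix.mul_smul, hP, Matrix.transpose_smul,
    Matrix.smul_mul, Matrix.mul_smul, Matrix.transpose_sub, Matrix.transpose_smul,
    Matrix.transpose_one, Matrix.sub_mul, Matrix.mul_sub, Matrix.mul_sub, Matrix.smul_mul,
    Matrix.mul_smul, Matrix.smul_mul, Matrix.mul_smul, hQ, hT, Matrix.one_mul, Matrix.one_mul,
    Matrix.mul_one, form1Core]
  -- At r = 0 the terms with 1/‖r‖² are 0 and both sides equal (1 + ‖x‖²)AᵀA.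
  by_cases h : ‖r‖ ^ 2 = 0
  · have : r = 0 := by simpa using h
    have hz : Matrix.vecMulVec x.ofLp (0 : EuclideanSpace ℝ (Fin m)).ofLp = 0 := by
      ext i j
      simp [Matrix.vecMulVec_apply]
    simp only [this, norm_zero, one_div, ne_eq, OfNat.ofNat_ne_zero, not_false_eq_true, zero_pow,
      inv_zero, zero_smul, sub_zero, add_zero, WithLp.ofLp_zero, Matrix.zero_vecMulVec,
      Matrix.mul_zero]
    rw [← WithLp.ofLp_zero, hz, Matrix.zero_mul]
    module
  · have h' : ‖r‖ ≠ 0 := fun h0 => h (by simp [h0])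
    match_scalars <;> field_simp
    all_goals ring

theorem form2_eq_form1 {M : Matrix (Fin n) (Fin n) ℝ} (hM : Mᵀ = M)
    (A : Matrix (Fin m) (Fin n) ℝ) (x : EuclideanSpace ℝ (Fin n))
    (r : EuclideanSpace ℝ (Fin m)) : form2 M A x r = form1 M A x r := by
  rw [form2, specNorm_eq_sqrt, Matrix.transpose_mul, Matrix.transpose_nonsing_inv, hM,
    Matrix.mul_assoc, ← Matrix.mul_assoc _ _ M⁻¹, Matrix.transpose_fromCols,
    Matrix.transpose_fromCols, Matrix.fromCols_mul_fromRows, Matrix.fromCols_mul_fromRows,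
    Matrix.transpose_transpose, form2_core_mul_transpose, ← Matrix.mul_assoc]
  rfl

/-! ### Orthogonal residuals -/

theorem transpose_mul_vecMulVec_eq_zero {A : Matrix (Fin m) (Fin n) ℝ}
    {r : EuclideanSpace ℝ (Fin m)} (hr : Matrix.toEuclideanLin Aᵀ r = 0) {s : Type*}
    (v : s → ℝ) : Aᵀ * Matrix.vecMulVec r.ofLp v = 0 := by
  have h : Aᵀ *ᵥ r.ofLp = 0 := by
    have := congrArg WithLp.ofLp hr
    simpa [Matrix.toLpLin_apply] using this
  ext i j
  have h1 := congrFun h i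
  simp only [Matrix.mulVec, dotProduct, Pi.zero_apply] at h1
  simp only [Matrix.mul_apply, Matrix.vecMulVec_apply, ← mul_assoc, ← Finset.sum_mul, h1,
    zero_mul, Matrix.zero_apply]

theorem vecMulVec_mul_eq_zero {A : Matrix (Fin m) (Fin n) ℝ}
    {r : EuclideanSpace ℝ (Fin m)} (hr : Matrix.toEuclideanLin Aᵀ r = 0) {s : Type*}
    (v : s → ℝ) : Matrix.vecMulVec v r.ofLp * A = 0 := by
  rw [← Matrix.transpose_inj, Matrix.transpose_mul, Matrix.transpose_vecMulVec,
    transpose_mul_vecMulVec_eq_zero hr, Matrix.transpose_zero]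

/-- Every term that distinguishes the general formulas at M = AᵀA from the OLS ones contains Aᵀr or
its transpose; the same holds for the two norms below. -/
theorem olsK_eq_matK {A : Matrix (Fin m) (Fin n) ℝ} {r : EuclideanSpace ℝ (Fin m)}
    (hr : Matrix.toEuclideanLin Aᵀ r = 0) (x : EuclideanSpace ℝ (Fin n)) :
    olsK A x r = matK (Aᵀ * A) A x r := by
  rw [olsK, matK, transpose_mul_vecMulVec_eq_zero hr, smul_zero, zero_sub]

theorem olsForm1_eq_form1 {A : Matrix (Fin m) (Fin n) ℝ} {r : EuclideanSpace ℝ (Fin m)}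
    (hr : Matrix.toEuclideanLin Aᵀ r = 0) (x : EuclideanSpace ℝ (Fin n)) :
    olsForm1 A x r = form1 (Aᵀ * A) A x r := by
  rw [olsForm1, form1, transpose_mul_vecMulVec_eq_zero hr, vecMulVec_mul_eq_zero hr, sub_zero,
    sub_zero]

theorem olsForm2_eq_form2 {A : Matrix (Fin m) (Fin n) ℝ} {r : EuclideanSpace ℝ (Fin m)}
    (hr : Matrix.toEuclideanLin Aᵀ r = 0) (x : EuclideanSpace ℝ (Fin n)) :
    olsForm2 A x r = form2 (Aᵀ * A) A x r := by
  rw [olsForm2, form2, Matrix.mul_sub, Matrix.mul_smul, transpose_mul_vecMulVec_eq_zero hr,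
    transpose_mul_vecMulVec_eq_zero hr, smul_zero, smul_zero, sub_zero, sub_zero, Matrix.mul_one]

/-! ### The normal equation without singular values, and implicit differentiation -/

/-- The linear map `vec [A b] ↦ A`, with values in operators. -/
noncomputable def matCLM (m n : ℕ) :
    Data m n →L[ℝ] EuclideanSpace ℝ (Fin n) →L[ℝ] EuclideanSpace ℝ (Fin m) :=
  LinearMap.toContinuousLinearMap
    { toFun := fun d => (Matrix.toEuclideanLin (dataMat d)).toContinuousLinearMap
      map_add' := fun d e => by rw [← map_add, ← map_add]; rfl
      map_smul' := fun c d => by rw [RingHom.id_apply, ← map_smul, ← map_smul]; rfl }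

/-- The linear map `vec [A b] ↦ Aᵀ`, with values in operators. -/
noncomputable def matTCLM (m n : ℕ) :
    Data m n →L[ℝ] EuclideanSpace ℝ (Fin m) →L[ℝ] EuclideanSpace ℝ (Fin n) :=
  LinearMap.toContinuousLinearMap
    { toFun := fun d => (Matrix.toEuclideanLin (dataMat d)ᵀ).toContinuousLinearMap
      map_add' := fun d e => by rw [← map_add, ← map_add]; rfl
      map_smul' := fun c d => by rw [RingHom.id_apply, ← map_smul, ← map_smul]; rfl }

/-- The linear map `vec [A b] ↦ b`. -/
noncomputable def rhsCLM (m n : ℕ) : Data m n →L[ℝ] EuclideanSpace ℝ (Fin m) :=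
  LinearMap.toContinuousLinearMap
    { toFun := dataRhs
      map_add' := fun _ _ => rfl
      map_smul' := fun _ _ => rfl }

theorem matTCLM_apply (d : Data m n) (r : EuclideanSpace ℝ (Fin m)) :
    matTCLM m n d r = Matrix.toEuclideanLin (dataMat d)ᵀ r := rfl

/-- The residual as a function of data and solution. -/
noncomputable def residFun (z : Data m n × EuclideanSpace ℝ (Fin n)) : EuclideanSpace ℝ (Fin m) :=
  matCLM m n z.1 z.2 - rhsCLM m n z.1

theorem residFun_apply (d : Data m n) (x : EuclideanSpace ℝ (Fin n)) :
    residFun (d, x) = resid (dataMat d) (dataRhs d) x := rfl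

/-- The polynomial equation characterising the solution of the three problems: `c = lam ^ 2` for
scaled total least squares and `c = 0` for ordinary least squares. -/
noncomputable def normalFun (c : ℝ) (z : Data m n × EuclideanSpace ℝ (Fin n)) :
    EuclideanSpace ℝ (Fin n) :=
  (1 + c * ‖z.2‖ ^ 2) • matTCLM m n z.1 (residFun z) - (c * ‖residFun z‖ ^ 2) • z.2

/-- The product rule, where the residual Ax - b has derivative `residFun (v, x)` + Au in the
direction (v, u). -/
theorem exists_hasFDerivAt_normalFun (c : ℝ) (d : Data m n) (x : EuclideanSpace ℝ (Fin n)) :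
    ∃ F' : Data m n × EuclideanSpace ℝ (Fin n) →L[ℝ] EuclideanSpace ℝ (Fin n),
      HasFDerivAt (normalFun c) F' (d, x) ∧
      ∀ v u, F' (v, u) = (1 + c * ‖x‖ ^ 2) • (matTCLM m n v (residFun (d, x))
            + matTCLM m n d (residFun (v, x) + matCLM m n d u))
          + (2 * c * inner ℝ x u) • matTCLM m n d (residFun (d, x))
          - (c * ‖residFun (d, x)‖ ^ 2) • u
          - (2 * c * inner ℝ (residFun (d, x)) (residFun (v, x) + matCLM m n d u)) • x := by
  have hr : HasFDerivAt (residFun (m := m) (n := n)) _ (d, x) :=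
    (((matCLM m n).hasFDerivAt.comp (d, x) hasFDerivAt_fst).clm_apply hasFDerivAt_snd).sub
      ((rhsCLM m n).hasFDerivAt.comp (d, x) hasFDerivAt_fst)
  have h1 := ((hasFDerivAt_snd (𝕜 := ℝ) (p := (d, x))).norm_sq.const_mul c).const_add 1
  have h2 := ((matTCLM m n).hasFDerivAt.comp (d, x) hasFDerivAt_fst).clm_apply hr
  have h3 := (hr.norm_sq.const_mul c).smul (hasFDerivAt_snd (𝕜 := ℝ) (p := (d, x)))
  refine ⟨_, (h1.smul h2).sub h3, fun v u => ?_⟩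
  have hv : residFun (v, x) = matCLM m n v x - rhsCLM m n v := rfl
  rw [hv]
  simp only [sub_apply, add_apply, ContinuousLinearMap.smulRight_apply]
  simp [inner_add_right, inner_sub_right]
  module

theorem toEuclideanLin_vecMulVec_apply {p : Type*} [Fintype p] (u : EuclideanSpace ℝ p)
    (r k : EuclideanSpace ℝ (Fin m)) :
    Matrix.toEuclideanLin (Matrix.vecMulVec u.ofLp r.ofLp) k = (inner ℝ r k : ℝ) • u := by
  ext i
  simp only [Matrix.toLpLin_apply, Matrix.mulVec, dotProduct, Matrix.vecMulVec_apply,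
    PiLp.inner_apply, PiLp.smul_apply, smul_eq_mul, Finset.sum_mul, RCLike.inner_apply,
    conj_trivial]
  exact Finset.sum_congr rfl fun j _ => by ring

theorem toEuclideanLin_matK_apply (M : Matrix (Fin n) (Fin n) ℝ) (A : Matrix (Fin m) (Fin n) ℝ)
    (x : EuclideanSpace ℝ (Fin n)) (r : EuclideanSpace ℝ (Fin m)) (v : Data m n) :
    Matrix.toEuclideanLin (matK M A x r) v = Matrix.toEuclideanLin M⁻¹
      ((2 / ‖r‖ ^ 2 * inner ℝ r (residFun (v, x))) • Matrix.toEuclideanLin Aᵀ r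
        - Matrix.toEuclideanLin Aᵀ (residFun (v, x)) - matTCLM m n v r) := by
  rw [matK, toEuclideanLin_mul_apply, map_sub Matrix.toEuclideanLin, LinearMap.sub_apply,
    toEuclideanLin_mul_apply, toEuclideanLin_kronX, toEuclideanLin_kronR, map_sub Matrix.toEuclideanLin, LinearMap.sub_apply, map_smul,
    LinearMap.smul_apply, toEuclideanLin_mul_apply, toEuclideanLin_vecMulVec_apply, map_smul,
    smul_smul, residFun_apply, matTCLM_apply]

/-- A continuous solution of the normal equation is differentiable, with derivative `matK`. -/
theorem hasFDerivAt_of_normalFun {c s : ℝ} (hc : 0 ≤ c) {g : Data m n → EuclideanSpace ℝ (Fin n)}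
    {A : Matrix (Fin m) (Fin n) ℝ} {b : EuclideanSpace ℝ (Fin m)}
    {x : EuclideanSpace ℝ (Fin n)} (hx : g (dataVec A b) = x)
    (hg : ContinuousAt g (dataVec A b))
    (h0 : ∀ᶠ d in 𝓝 (dataVec A b), normalFun c (d, g d) = 0)
    (hs : c * ‖resid A b x‖ ^ 2 = s ^ 2 * (1 + c * ‖x‖ ^ 2))
    (hr : Matrix.toEuclideanLin Aᵀ (resid A b x) = s ^ 2 • x)
    (hM : IsUnit (gramShift A s).det) :
    HasFDerivAt g (Matrix.toEuclideanLin
      (matK (gramShift A s) A x (resid A b x))).toContinuousLinearMap (dataVec A b) := by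
  obtain ⟨F', hF, hF'⟩ := exists_hasFDerivAt_normalFun c (dataVec A b) x
  rw [← hx] at hF
  -- The two rank one terms in u, both multiples of ⟨x, u⟩x, cancel by `hin`. What remains of the
  -- partial derivative is (1 + c‖x‖²)M, which `P` inverts.
  refine HasFDerivAt.of_implicit (P := (1 + c * ‖x‖ ^ 2)⁻¹ •
    (Matrix.toEuclideanLin (gramShift A s)⁻¹).toContinuousLinearMap) hg hF h0 fun v u => ?_
  have hN : (1 + c * ‖x‖ ^ 2) ≠ 0 := by positivity
  have hres : residFun (dataVec A b, x) = resid A b x := rfl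
  have hA : ∀ u, matCLM m n (dataVec A b) u = Matrix.toEuclideanLin A u := fun _ => rfl
  have hAT : ∀ u, matTCLM m n (dataVec A b) u = Matrix.toEuclideanLin Aᵀ u := fun _ => rfl
  rw [hF', LinearMap.coe_toContinuousLinearMap', toEuclideanLin_matK_apply, hres]
  simp only [hA, hAT, hr]
  set r := resid A b x with hrdef
  set k := residFun (v, x) with hk
  have hin : inner ℝ r (Matrix.toEuclideanLin A u) = s ^ 2 * inner ℝ x u := by
    rw [← inner_toEuclideanLin_transpose, hr, real_inner_smul_left]
  -- This is the origin of 2/‖r‖² in K: by `hs`, c equals (1 + c‖x‖²)s²/‖r‖², and s²x is Aᵀr. At r =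
  -- 0 both sides vanish.
  have hrk : 2 * c * inner ℝ r k
      = (1 + c * ‖x‖ ^ 2) * (2 / ‖r‖ ^ 2 * inner ℝ r k * s ^ 2) := by
    by_cases h : ‖r‖ ^ 2 = 0
    · have : r = 0 := by simpa using h
      simp [this]
    · have h' : ‖r‖ ≠ 0 := fun h0 => h (by simp [h0])
      field_simp
      linear_combination inner ℝ r k * hs
  rw [smul_apply, LinearMap.coe_toContinuousLinearMap', ← map_smul, ← map_add, eq_comm,
    eq_inv_apply_iff hM, toEuclideanLin_gramShift, inner_add_right, hin, hs, map_add, mul_add (2 * c), hrk]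
  set N := 1 + c * ‖x‖ ^ 2
  match_scalars <;> field_simp <;> ring

/-! ### Continuity -/

theorem continuous_dataMat : Continuous (dataMat : Data m n → Matrix (Fin m) (Fin n) ℝ) := by
  unfold dataMat
  refine continuous_matrix fun i j => ?_
  simp only [Matrix.of_apply]
  fun_prop

theorem continuous_dataRhs : Continuous (dataRhs : Data m n → EuclideanSpace ℝ (Fin m)) :=
  (rhsCLM m n).continuous

theorem continuous_aug : Continuous fun p : Matrix (Fin m) (Fin n) ℝ × EuclideanSpace ℝ (Fin m) =>
    aug p.1 p.2 := by
  refine continuous_matrix fun i j => ?_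
  rcases j with j | j
  · simp only [aug, Matrix.fromCols_apply_inl]
    fun_prop
  · simp only [aug, Matrix.fromCols_apply_inr, Matrix.replicateCol_apply]
    fun_prop

theorem continuous_toEuclideanLin_apply {p q : Type*} [Fintype p] [Fintype q] [DecidableEq q] :
    Continuous fun z : Matrix p q ℝ × EuclideanSpace ℝ q => Matrix.toEuclideanLin z.1 z.2 := by
  simp only [Matrix.toLpLin_apply]
  exact (PiLp.continuous_toLp 2 _).comp
    (continuous_fst.matrix_mulVec ((PiLp.continuous_ofLp 2 _).comp continuous_snd))

theorem continuous_gramShift : Continuous fun p : Matrix (Fin m) (Fin n) ℝ × ℝ =>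
    gramShift p.1 p.2 := by
  unfold gramShift
  fun_prop

theorem continuousAt_matrix_inv {M : Matrix (Fin n) (Fin n) ℝ} (hM : IsUnit M.det) :
    ContinuousAt (fun N : Matrix (Fin n) (Fin n) ℝ => N⁻¹) M := by
  simp only [Matrix.inv_def, Ring.inverse_eq_inv']
  exact ((Continuous.matrix_det continuous_id).continuousAt.inv₀ hM.ne_zero).smul
    (Continuous.matrix_adjugate continuous_id).continuousAt

theorem tendsto_matrix_inv {α : Type*} {l : Filter α} {M : α → Matrix (Fin n) (Fin n) ℝ}
    {M₀ : Matrix (Fin n) (Fin n) ℝ} (hM₀ : IsUnit M₀.det) (hM : Tendsto M l (𝓝 M₀)) :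
    Tendsto (fun a => (M a)⁻¹) l (𝓝 M₀⁻¹) :=
  Tendsto.comp (g := fun N : Matrix (Fin n) (Fin n) ℝ => N⁻¹) (continuousAt_matrix_inv hM₀) hM

theorem tendsto_gramShift {α : Type*} {l : Filter α} {A : α → Matrix (Fin m) (Fin n) ℝ}
    {s : α → ℝ} {A₀ : Matrix (Fin m) (Fin n) ℝ} {s₀ : ℝ} (hA : Tendsto A l (𝓝 A₀))
    (hs : Tendsto s l (𝓝 s₀)) :
    Tendsto (fun a => gramShift (A a) (s a)) l (𝓝 (gramShift A₀ s₀)) :=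
  Continuous.tendsto_apply₂ (f := gramShift) continuous_gramShift hA hs

theorem tendsto_mul_apply {α : Type*} {l : Filter α} {N : α → Matrix (Fin n) (Fin n) ℝ}
    {B : α → Matrix (Fin n) (Fin m) ℝ} {b : α → EuclideanSpace ℝ (Fin m)}
    {N₀ : Matrix (Fin n) (Fin n) ℝ} {B₀ : Matrix (Fin n) (Fin m) ℝ}
    {b₀ : EuclideanSpace ℝ (Fin m)} (hN : Tendsto N l (𝓝 N₀)) (hB : Tendsto B l (𝓝 B₀))
    (hb : Tendsto b l (𝓝 b₀)) :
    Tendsto (fun a => Matrix.toEuclideanLin (N a * B a) (b a)) l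
      (𝓝 (Matrix.toEuclideanLin (N₀ * B₀) b₀)) := by
  have h : Tendsto (fun a => N a * B a) l (𝓝 (N₀ * B₀)) :=
    Continuous.tendsto_apply₂ (f := fun (N : Matrix (Fin n) (Fin n) ℝ)
      (B : Matrix (Fin n) (Fin m) ℝ) => N * B) (continuous_fst.matrix_mul continuous_snd) hN hB
  exact Continuous.tendsto_apply₂ (f := fun (X : Matrix (Fin n) (Fin m) ℝ)
    (y : EuclideanSpace ℝ (Fin m)) => Matrix.toEuclideanLin X y)
    continuous_toEuclideanLin_apply h hb

theorem continuous_form1Core (A : Matrix (Fin m) (Fin n) ℝ) :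
    Continuous fun p : EuclideanSpace ℝ (Fin n) × EuclideanSpace ℝ (Fin m) =>
      form1Core A p.1 p.2 := by
  have h1 : Continuous fun p : EuclideanSpace ℝ (Fin n) × EuclideanSpace ℝ (Fin m) =>
    p.1.ofLp := (PiLp.continuous_ofLp 2 _).comp continuous_fst
  have h2 : Continuous fun p : EuclideanSpace ℝ (Fin n) × EuclideanSpace ℝ (Fin m) =>
    p.2.ofLp := (PiLp.continuous_ofLp 2 _).comp continuous_snd
  have h3 := continuous_const (y := Aᵀ) |>.matrix_mul (h2.matrix_vecMulVec h1)
  have h4 := (h1.matrix_vecMulVec h2).matrix_mul (continuous_const (y := A))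
  have h5 : Continuous fun p : EuclideanSpace ℝ (Fin n) × EuclideanSpace ℝ (Fin m) =>
    (1 + ‖p.1‖ ^ 2) • (Aᵀ * A) := by fun_prop
  have h6 : Continuous fun p : EuclideanSpace ℝ (Fin n) × EuclideanSpace ℝ (Fin m) =>
    ‖p.2‖ ^ 2 • (1 : Matrix (Fin n) (Fin n) ℝ) := by fun_prop
  exact ((h5.sub h3).sub h4).add h6

/-- The limit r₀ = 0 is permitted, since `form1` has no division by ‖r‖; the limits of the other two
expressions are deduced from this one. -/
theorem tendsto_form1 {α : Type*} {l : Filter α} {M : α → Matrix (Fin n) (Fin n) ℝ}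
    {x : α → EuclideanSpace ℝ (Fin n)} {r : α → EuclideanSpace ℝ (Fin m)}
    {M₀ : Matrix (Fin n) (Fin n) ℝ} {x₀ : EuclideanSpace ℝ (Fin n)}
    {r₀ : EuclideanSpace ℝ (Fin m)} (A : Matrix (Fin m) (Fin n) ℝ)
    (hM : Tendsto (fun a => (M a)⁻¹) l (𝓝 M₀⁻¹)) (hx : Tendsto x l (𝓝 x₀))
    (hr : Tendsto r l (𝓝 r₀)) :
    Tendsto (fun a => form1 (M a) A (x a) (r a)) l (𝓝 (form1 M₀ A x₀ r₀)) := by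
  have hc : Continuous fun p : Matrix (Fin n) (Fin n) ℝ × Matrix (Fin n) (Fin n) ℝ =>
      Real.sqrt (specNorm (p.1 * p.2 * p.1)) :=
    Real.continuous_sqrt.comp (continuous_specNorm.comp
      ((continuous_fst.matrix_mul continuous_snd).matrix_mul continuous_fst))
  exact Continuous.tendsto_apply₂ (f := fun N C : Matrix (Fin n) (Fin n) ℝ =>
    Real.sqrt (specNorm (N * C * N))) hc hM
    (Continuous.tendsto_apply₂ (f := form1Core A) (continuous_form1Core A) hx hr)

theorem absCond_eq_specNorm {F : Data m n → EuclideanSpace ℝ (Fin n)}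
    {A : Matrix (Fin m) (Fin n) ℝ} {b : EuclideanSpace ℝ (Fin m)}
    {K : Matrix (Fin n) ((Fin n ⊕ Unit) × Fin m) ℝ}
    (h : HasFDerivAt F (Matrix.toEuclideanLin K).toContinuousLinearMap (dataVec A b)) :
    absCond F A b = specNorm K := by
  rw [absCond, h.fderiv, specNorm]

/-! ### The solution map of the scaled total least squares problem -/

theorem continuous_sv_aug (lam : ℝ) :
    Continuous fun d : Data m n => sv (aug (dataMat d) (lam • dataRhs d)) n :=
  (continuous_sv (by simp)).comp (continuous_aug.comp
    (continuous_dataMat.prodMk (continuous_dataRhs.const_smul lam)))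

theorem continuous_sv_dataMat (hn : 0 < n) :
    Continuous fun d : Data m n => sv (dataMat d) (n - 1) :=
  (continuous_sv (by simp; omega)).comp continuous_dataMat

theorem eventually_gap (hn : 0 < n) (lam : ℝ) {A : Matrix (Fin m) (Fin n) ℝ}
    {b : EuclideanSpace ℝ (Fin m)} (hgap : sv (aug A (lam • b)) n < sv A (n - 1)) :
    ∀ᶠ d in 𝓝 (dataVec A b),
      sv (aug (dataMat d) (lam • dataRhs d)) n < sv (dataMat d) (n - 1) :=
  (continuous_sv_aug lam).continuousAt.eventually_lt (continuous_sv_dataMat hn).continuousAt hgap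

/-- The gap persists near the data, so the formula M⁻¹Aᵀb holds there, and it depends on the
smallest singular value only through a continuous expression. -/
theorem continuousAt_stlsMap (hn : 0 < n) {lam : ℝ} (hlam : lam ≠ 0)
    {A : Matrix (Fin m) (Fin n) ℝ} {b : EuclideanSpace ℝ (Fin m)}
    (hgap : sv (aug A (lam • b)) n < sv A (n - 1)) :
    ContinuousAt (stlsMap lam) (dataVec A b) := by
  have h4 : ContinuousAt (fun d : Data m n => Matrix.toEuclideanLin
      ((stlsM lam (dataMat d) (dataRhs d))⁻¹ * (dataMat d)ᵀ) (dataRhs d)) (dataVec A b) :=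
    tendsto_mul_apply
      (tendsto_matrix_inv (isUnit_det_gramShift hn A (sv_nonneg _ _) hgap)
        (tendsto_gramShift continuous_dataMat.continuousAt (continuous_sv_aug lam).continuousAt))
      continuous_dataMat.matrix_transpose.continuousAt continuous_dataRhs.continuousAt
  refine h4.congr ?_
  filter_upwards [eventually_gap hn lam hgap] with d hd
  exact (stlsSol_eq hn hlam _ _ hd).symm

theorem hasFDerivAt_stlsMap (hn : 0 < n) {lam : ℝ} (hlam : lam ≠ 0)
    {A : Matrix (Fin m) (Fin n) ℝ} {b : EuclideanSpace ℝ (Fin m)}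
    (hgap : sv (aug A (lam • b)) n < sv A (n - 1)) :
    HasFDerivAt (stlsMap lam) (Matrix.toEuclideanLin (stlsK lam A b)).toContinuousLinearMap
      (dataVec A b) := by
  refine hasFDerivAt_of_normalFun (sq_nonneg lam) rfl (continuousAt_stlsMap hn hlam hgap) ?_
    (sq_mul_norm_sq_stlsRes hn hlam A b hgap) (transpose_stlsRes hn hlam A b hgap)
    (isUnit_det_gramShift hn A (sv_nonneg _ _) hgap)
  filter_upwards [eventually_gap hn lam hgap] with d hd
  have h1 := sq_mul_norm_sq_stlsRes hn hlam _ _ hd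
  have h2 := transpose_stlsRes hn hlam _ _ hd
  have h3 : residFun (d, stlsMap lam d) = stlsRes lam (dataMat d) (dataRhs d) := rfl
  -- With σ for the singular value at `d`, both terms of `normalFun` become σ²(1 + lam²‖x‖²)x.
  rw [normalFun, h3, matTCLM_apply, h1, h2, stlsMap]
  module

theorem stlsM_transpose (lam : ℝ) (A : Matrix (Fin m) (Fin n) ℝ)
    (b : EuclideanSpace ℝ (Fin m)) : (stlsM lam A b)ᵀ = stlsM lam A b :=
  gramShift_transpose _ _

theorem absCond_stlsMap_eq_stlsForm1 (hn : 0 < n) {lam : ℝ} (hlam : lam ≠ 0)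
    {A : Matrix (Fin m) (Fin n) ℝ} {b : EuclideanSpace ℝ (Fin m)}
    (hgap : sv (aug A (lam • b)) n < sv A (n - 1)) :
    absCond (stlsMap lam) A b = stlsForm1 lam A b := by
  rw [absCond_eq_specNorm (hasFDerivAt_stlsMap hn hlam hgap), stlsK,
    specNorm_matK (stlsM_transpose lam A b), stlsForm1]

theorem stlsForm2_eq_stlsForm1 (lam : ℝ) (A : Matrix (Fin m) (Fin n) ℝ)
    (b : EuclideanSpace ℝ (Fin m)) : stlsForm2 lam A b = stlsForm1 lam A b :=
  form2_eq_form1 (stlsM_transpose lam A b) _ _ _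

/-! ### Total least squares -/

theorem isSTLSSolution_one_iff (A : Matrix (Fin m) (Fin n) ℝ) (b : EuclideanSpace ℝ (Fin m))
    (x : EuclideanSpace ℝ (Fin n)) : IsSTLSSolution 1 A b x ↔ IsTLSSolution A b x := by
  rw [isSTLSSolution_iff_isTLSSolution, one_smul, one_smul]

/-- Both sides are choices from one and the same predicate, so no uniqueness is involved. -/
theorem stlsSol_one (A : Matrix (Fin m) (Fin n) ℝ) (b : EuclideanSpace ℝ (Fin m)) :
    stlsSol 1 A b = tlsSol A b := by
  rw [stlsSol, tlsSol, funext fun x => propext (isSTLSSolution_one_iff A b x)]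

theorem stlsMap_one : (stlsMap 1 : Data m n → EuclideanSpace ℝ (Fin n)) = tlsMap :=
  funext fun _ => stlsSol_one _ _

theorem stlsM_one (A : Matrix (Fin m) (Fin n) ℝ) (b : EuclideanSpace ℝ (Fin m)) :
    stlsM 1 A b = tlsM A b := by
  rw [stlsM, tlsM, one_smul]

theorem stlsRes_one (A : Matrix (Fin m) (Fin n) ℝ) (b : EuclideanSpace ℝ (Fin m)) :
    stlsRes 1 A b = tlsRes A b := by
  rw [stlsRes, tlsRes, stlsSol_one]

theorem stlsK_one (A : Matrix (Fin m) (Fin n) ℝ) (b : EuclideanSpace ℝ (Fin m)) :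
    stlsK 1 A b = tlsK A b := by
  rw [stlsK, tlsK, stlsM_one, stlsRes_one, stlsSol_one]

/-! ### Ordinary least squares -/

/-- With indices starting at 0, a singular value is positive exactly when its index is below the
rank, and n - 1 < n as n > 0. -/
theorem sv_pos_of_rank_eq (hn : 0 < n) {A : Matrix (Fin m) (Fin n) ℝ} (hA : A.rank = n) :
    0 < sv A (n - 1) := by
  rw [sv, LinearMap.singularValues_pos_iff_lt_finrank_range]
  have := Matrix.rank_eq_finrank_range_toLin A (EuclideanSpace.basisFun (Fin m) ℝ).toBasis
    (EuclideanSpace.basisFun (Fin n) ℝ).toBasis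
  rw [← Matrix.toEuclideanLin_eq_toLin_orthonormal, hA] at this
  omega

/-- Along each line the squared residual is a quadratic polynomial with nonnegative leading
coefficient, whose linear coefficient is twice the inner product of Aᵀr with the direction. -/
theorem isOLSSolution_iff (A : Matrix (Fin m) (Fin n) ℝ) (b : EuclideanSpace ℝ (Fin m))
    (x : EuclideanSpace ℝ (Fin n)) :
    IsOLSSolution A b x ↔ Matrix.toEuclideanLin Aᵀ (resid A b x) = 0 := by
  have key : ∀ z (t : ℝ), ‖resid A b (x + t • z)‖ ^ 2 = ‖resid A b x‖ ^ 2
      + (2 * t * inner ℝ (Matrix.toEuclideanLin Aᵀ (resid A b x)) z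
        + t ^ 2 * ‖Matrix.toEuclideanLin A z‖ ^ 2) := by
    intro z t
    have h1 : resid A b (x + t • z) = resid A b x + t • Matrix.toEuclideanLin A z := by
      simp only [resid, map_add, map_smul]
      module
    rw [h1, norm_add_sq_real, norm_smul, real_inner_smul_right, mul_pow, Real.norm_eq_abs,
      sq_abs, inner_toEuclideanLin_transpose]
    ring
  constructor
  · intro h
    refine ext_inner_right ℝ fun z => ?_
    rw [inner_zero_left]
    refine eq_zero_of_forall_quadratic_nonneg (c := ‖Matrix.toEuclideanLin A z‖ ^ 2) fun t => ?_
    have h1 := pow_le_pow_left₀ (norm_nonneg _) (h (x + t • z)) 2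
    rw [key] at h1
    linarith
  · intro h y
    refine le_of_sq_le_sq ?_ (norm_nonneg _)
    have h1 := key (y - x) 1
    rw [h, inner_zero_left, one_smul, add_sub_cancel] at h1
    rw [h1]
    nlinarith [sq_nonneg ‖Matrix.toEuclideanLin A (y - x)‖]

theorem gramShift_zero (A : Matrix (Fin m) (Fin n) ℝ) : gramShift A 0 = Aᵀ * A := by
  simp [gramShift]

theorem isUnit_det_gram (hn : 0 < n) {A : Matrix (Fin m) (Fin n) ℝ} (hA : 0 < sv A (n - 1)) :
    IsUnit (Aᵀ * A).det :=
  gramShift_zero A ▸ isUnit_det_gramShift hn A le_rfl hA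

theorem isOLSSolution_iff_eq (hn : 0 < n) {A : Matrix (Fin m) (Fin n) ℝ}
    (hA : 0 < sv A (n - 1)) (b : EuclideanSpace ℝ (Fin m)) (x : EuclideanSpace ℝ (Fin n)) :
    IsOLSSolution A b x ↔ x = Matrix.toEuclideanLin ((Aᵀ * A)⁻¹ * Aᵀ) b := by
  rw [isOLSSolution_iff, toEuclideanLin_mul_apply, eq_inv_apply_iff (isUnit_det_gram hn hA),
    toEuclideanLin_mul_apply, resid, map_sub, sub_eq_zero]

theorem isOLSSolution_olsSol (hn : 0 < n) {A : Matrix (Fin m) (Fin n) ℝ}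
    (hA : 0 < sv A (n - 1)) (b : EuclideanSpace ℝ (Fin m)) : IsOLSSolution A b (olsSol A b) :=
  Classical.epsilon_spec ⟨_, (isOLSSolution_iff_eq hn hA b _).2 rfl⟩

theorem olsSol_eq (hn : 0 < n) {A : Matrix (Fin m) (Fin n) ℝ}
    (hA : 0 < sv A (n - 1)) (b : EuclideanSpace ℝ (Fin m)) :
    olsSol A b = Matrix.toEuclideanLin ((Aᵀ * A)⁻¹ * Aᵀ) b :=
  (isOLSSolution_iff_eq hn hA b _).1 (isOLSSolution_olsSol hn hA b)

theorem transpose_olsRes (hn : 0 < n) {A : Matrix (Fin m) (Fin n) ℝ}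
    (hA : 0 < sv A (n - 1)) (b : EuclideanSpace ℝ (Fin m)) :
    Matrix.toEuclideanLin Aᵀ (olsRes A b) = 0 :=
  (isOLSSolution_iff A b _).1 (isOLSSolution_olsSol hn hA b)

theorem eventually_sv_pos (hn : 0 < n) {A : Matrix (Fin m) (Fin n) ℝ}
    (hA : 0 < sv A (n - 1)) (b : EuclideanSpace ℝ (Fin m)) :
    ∀ᶠ d in 𝓝 (dataVec A b), 0 < sv (dataMat d) (n - 1) :=
  (continuous_sv_dataMat hn).continuousAt.eventually_const_lt hA

theorem continuousAt_olsMap (hn : 0 < n) {A : Matrix (Fin m) (Fin n) ℝ}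
    (hA : 0 < sv A (n - 1)) (b : EuclideanSpace ℝ (Fin m)) :
    ContinuousAt olsMap (dataVec A b) := by
  have h4 : ContinuousAt (fun d : Data m n => Matrix.toEuclideanLin
      (((dataMat d)ᵀ * dataMat d)⁻¹ * (dataMat d)ᵀ) (dataRhs d)) (dataVec A b) :=
    tendsto_mul_apply
      (tendsto_matrix_inv (isUnit_det_gram hn hA)
        (continuous_dataMat.matrix_transpose.matrix_mul continuous_dataMat).continuousAt)
      continuous_dataMat.matrix_transpose.continuousAt continuous_dataRhs.continuousAt
  refine h4.congr ?_
  filter_upwards [eventually_sv_pos hn hA b] with d hd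
  exact (olsSol_eq hn hd _).symm

/-- The case c = 0, s = 0 of `hasFDerivAt_of_normalFun`, in which `normalFun` is Aᵀr. -/
theorem hasFDerivAt_olsMap (hn : 0 < n) {A : Matrix (Fin m) (Fin n) ℝ}
    (hA : 0 < sv A (n - 1)) (b : EuclideanSpace ℝ (Fin m)) :
    HasFDerivAt olsMap
      (Matrix.toEuclideanLin (olsK A (olsSol A b) (olsRes A b))).toContinuousLinearMap
      (dataVec A b) := by
  rw [olsK_eq_matK (transpose_olsRes hn hA b), ← gramShift_zero]
  refine hasFDerivAt_of_normalFun le_rfl rfl (continuousAt_olsMap hn hA b) ?_ (by simp)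
    ((transpose_olsRes hn hA b).trans (by simp)) (isUnit_det_gramShift hn A le_rfl hA)
  filter_upwards [eventually_sv_pos hn hA b] with d hd
  have h2 := transpose_olsRes hn hd (dataRhs d)
  have h3 : residFun (d, olsMap d) = olsRes (dataMat d) (dataRhs d) := rfl
  simp [normalFun, h3, matTCLM_apply, h2]

/-! ### The limit of a vanishing scaling parameter -/

/-- The Rayleigh bound at y = 0, whose residual is -λb. -/
theorem sv_aug_smul_le (lam : ℝ) (A : Matrix (Fin m) (Fin n) ℝ) (b : EuclideanSpace ℝ (Fin m)) :
    sv (aug A (lam • b)) n ≤ |lam| * ‖b‖ := by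
  refine le_of_sq_le_sq ?_ (by positivity)
  have h := sq_mul_le_resid A (lam • b) 0
  simpa [resid, norm_smul, mul_pow] using h

theorem tendsto_sv_aug_smul (A : Matrix (Fin m) (Fin n) ℝ) (b : EuclideanSpace ℝ (Fin m)) :
    Tendsto (fun lam : ℝ => sv (aug A (lam • b)) n) (𝓝[>] 0) (𝓝 0) := by
  refine squeeze_zero (fun _ => sv_nonneg _ _) (fun lam => sv_aug_smul_le lam A b) ?_
  have : Continuous fun lam : ℝ => |lam| * ‖b‖ := by fun_prop
  simpa using (this.tendsto 0).mono_left nhdsWithin_le_nhds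

theorem tendsto_stlsM_inv (hn : 0 < n) {A : Matrix (Fin m) (Fin n) ℝ}
    (hA : 0 < sv A (n - 1)) (b : EuclideanSpace ℝ (Fin m)) :
    Tendsto (fun lam : ℝ => (stlsM lam A b)⁻¹) (𝓝[>] 0) (𝓝 (Aᵀ * A)⁻¹) := by
  refine tendsto_matrix_inv (isUnit_det_gram hn hA) ?_
  rw [← gramShift_zero]
  exact tendsto_gramShift tendsto_const_nhds (tendsto_sv_aug_smul A b)

theorem eventually_gap_smul {A : Matrix (Fin m) (Fin n) ℝ}
    (hA : 0 < sv A (n - 1)) (b : EuclideanSpace ℝ (Fin m)) :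
    ∀ᶠ lam in 𝓝[>] (0 : ℝ), sv (aug A (lam • b)) n < sv A (n - 1) :=
  (tendsto_sv_aug_smul A b).eventually_lt_const hA

theorem tendsto_stlsSol (hn : 0 < n) {A : Matrix (Fin m) (Fin n) ℝ}
    (hA : 0 < sv A (n - 1)) (b : EuclideanSpace ℝ (Fin m)) :
    Tendsto (fun lam : ℝ => stlsSol lam A b) (𝓝[>] 0) (𝓝 (olsSol A b)) := by
  rw [olsSol_eq hn hA]
  refine (tendsto_mul_apply (tendsto_stlsM_inv hn hA b) tendsto_const_nhds
    (tendsto_const_nhds (x := b))).congr' ?_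
  filter_upwards [eventually_gap_smul hA b, self_mem_nhdsWithin] with lam hgap hlam
  exact (stlsSol_eq hn (ne_of_gt hlam) A b hgap).symm

theorem tendsto_stlsForm1 (hn : 0 < n) {A : Matrix (Fin m) (Fin n) ℝ}
    (hA : 0 < sv A (n - 1)) (b : EuclideanSpace ℝ (Fin m)) :
    Tendsto (fun lam : ℝ => stlsForm1 lam A b) (𝓝[>] 0)
      (𝓝 (olsForm1 A (olsSol A b) (olsRes A b))) := by
  rw [olsForm1_eq_form1 (transpose_olsRes hn hA b)]
  have hx := tendsto_stlsSol hn hA b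
  refine tendsto_form1 A (tendsto_stlsM_inv hn hA b) hx ?_
  have : Continuous fun x => resid A b x := by
    unfold resid
    exact (LinearMap.continuous_of_finiteDimensional _).sub continuous_const
  exact (this.tendsto _).comp hx

theorem gram_transpose (A : Matrix (Fin m) (Fin n) ℝ) : (Aᵀ * A)ᵀ = Aᵀ * A := by simp

theorem specNorm_olsK (hn : 0 < n) {A : Matrix (Fin m) (Fin n) ℝ}
    (hA : 0 < sv A (n - 1)) (b : EuclideanSpace ℝ (Fin m)) :
    specNorm (olsK A (olsSol A b) (olsRes A b)) = olsForm1 A (olsSol A b) (olsRes A b) := by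
  have hr := transpose_olsRes hn hA b
  rw [olsK_eq_matK hr, olsForm1_eq_form1 hr, specNorm_matK (gram_transpose A)]

theorem olsForm2_eq_olsForm1 (hn : 0 < n) {A : Matrix (Fin m) (Fin n) ℝ}
    (hA : 0 < sv A (n - 1)) (b : EuclideanSpace ℝ (Fin m)) :
    olsForm2 A (olsSol A b) (olsRes A b) = olsForm1 A (olsSol A b) (olsRes A b) := by
  have hr := transpose_olsRes hn hA b
  rw [olsForm2_eq_form2 hr, olsForm1_eq_form1 hr, form2_eq_form1 (gram_transpose A)]

end STLS



/-! ### The theorem -/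

theorem theorem3 {m n : ℕ} (hn : 0 < n) (hmn : n < m)
    (A : Matrix (Fin m) (Fin n) ℝ) (b : EuclideanSpace ℝ (Fin m)) :
    -- the scaled total least squares problem
    (∀ lam : ℝ, 0 < lam → sv (aug A (lam • b)) n < sv A (n - 1) →
      (∀ᶠ d in 𝓝 (dataVec A b), ∃! x, IsSTLSSolution lam (dataMat d) (dataRhs d) x) ∧
      IsSTLSSolution lam A b (stlsSol lam A b) ∧
      IsUnit (stlsM lam A b).det ∧
      stlsSol lam A b = Matrix.toEuclideanLin ((stlsM lam A b)⁻¹ * Aᵀ) b ∧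
      HasFDerivAt (stlsMap lam)
        (Matrix.toEuclideanLin (stlsK lam A b)).toContinuousLinearMap (dataVec A b) ∧
      absCond (stlsMap lam) A b = specNorm (stlsK lam A b) ∧
      absCond (stlsMap lam) A b = stlsForm1 lam A b ∧
      absCond (stlsMap lam) A b = stlsForm2 lam A b) ∧
    -- the case `lam = 1`: the total least squares problem
    (sv (aug A b) n < sv A (n - 1) →
      (∀ x, IsSTLSSolution 1 A b x ↔ IsTLSSolution A b x) ∧
      (∀ᶠ d in 𝓝 (dataVec A b), ∃! x, IsTLSSolution (dataMat d) (dataRhs d) x) ∧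
      IsTLSSolution A b (tlsSol A b) ∧
      stlsSol 1 A b = tlsSol A b ∧
      absCond (stlsMap 1) A b = absCond tlsMap A b ∧
      HasFDerivAt tlsMap
        (Matrix.toEuclideanLin (tlsK A b)).toContinuousLinearMap (dataVec A b) ∧
      absCond tlsMap A b = specNorm (tlsK A b) ∧
      absCond tlsMap A b = form1 (tlsM A b) A (tlsSol A b) (tlsRes A b) ∧
      absCond tlsMap A b = form2 (tlsM A b) A (tlsSol A b) (tlsRes A b)) ∧
    -- the limit `lam → 0` for `A` of full column rank: the ordinary least squares problem
    (A.rank = n →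
      (∀ᶠ lam in 𝓝[>] (0 : ℝ), sv (aug A (lam • b)) n < sv A (n - 1)) ∧
      Tendsto (fun lam : ℝ => sv (aug A (lam • b)) n) (𝓝[>] 0) (𝓝 0) ∧
      Tendsto (fun lam : ℝ => (stlsM lam A b)⁻¹) (𝓝[>] 0) (𝓝 (Aᵀ * A)⁻¹) ∧
      Tendsto (fun lam : ℝ => stlsSol lam A b) (𝓝[>] 0) (𝓝 (olsSol A b)) ∧
      (∀ᶠ d in 𝓝 (dataVec A b), ∃! x, IsOLSSolution (dataMat d) (dataRhs d) x) ∧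
      IsOLSSolution A b (olsSol A b) ∧
      Matrix.toEuclideanLin Aᵀ (olsRes A b) = 0 ∧
      HasFDerivAt olsMap
        (Matrix.toEuclideanLin (olsK A (olsSol A b) (olsRes A b))).toContinuousLinearMap
        (dataVec A b) ∧
      absCond olsMap A b = specNorm (olsK A (olsSol A b) (olsRes A b)) ∧
      absCond olsMap A b = olsForm1 A (olsSol A b) (olsRes A b) ∧
      absCond olsMap A b = olsForm2 A (olsSol A b) (olsRes A b) ∧
      Tendsto (fun lam : ℝ => absCond (stlsMap lam) A b) (𝓝[>] 0)
        (𝓝 (specNorm (olsK A (olsSol A b) (olsRes A b)))) ∧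
      Tendsto (fun lam : ℝ => stlsForm1 lam A b) (𝓝[>] 0)
        (𝓝 (olsForm1 A (olsSol A b) (olsRes A b))) ∧
      Tendsto (fun lam : ℝ => stlsForm2 lam A b) (𝓝[>] 0)
        (𝓝 (olsForm2 A (olsSol A b) (olsRes A b)))) := by
  refine ⟨fun lam hlam hgap => ?_, fun hgap => ?_, fun hrank => ?_⟩
  · have hlam := hlam.ne'
    have hD := hasFDerivAt_stlsMap hn hlam hgap
    have h1 := absCond_stlsMap_eq_stlsForm1 hn hlam hgap
    refine ⟨?_, isSTLSSolution_stlsSol hn hlam A b hgap,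
      isUnit_det_gramShift hn A (sv_nonneg _ _) hgap, stlsSol_eq hn hlam A b hgap, hD,
      absCond_eq_specNorm hD, h1, h1.trans (stlsForm2_eq_stlsForm1 lam A b).symm⟩
    filter_upwards [eventually_gap hn lam hgap] with d hd
    exact existsUnique_isSTLSSolution hn hlam _ _ hd
  · have hgap1 : sv (aug A ((1 : ℝ) • b)) n < sv A (n - 1) := by rwa [one_smul]
    have hD := hasFDerivAt_stlsMap hn one_ne_zero hgap1
    have h1 := absCond_stlsMap_eq_stlsForm1 hn one_ne_zero hgap1
    have h2 := h1.trans (stlsForm2_eq_stlsForm1 1 A b).symm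
    rw [stlsMap_one, stlsK_one] at hD
    rw [stlsMap_one, stlsForm1, stlsM_one, stlsRes_one, stlsSol_one] at h1
    rw [stlsMap_one, stlsForm2, stlsM_one, stlsRes_one, stlsSol_one] at h2
    refine ⟨isSTLSSolution_one_iff A b, ?_, ?_, stlsSol_one A b, by rw [stlsMap_one], hD,
      absCond_eq_specNorm hD, h1, h2⟩
    · filter_upwards [eventually_gap hn 1 hgap1] with d hd
      simpa only [isSTLSSolution_one_iff] using existsUnique_isSTLSSolution hn one_ne_zero _ _ hd
    · rw [← isSTLSSolution_one_iff, ← stlsSol_one]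
      exact isSTLSSolution_stlsSol hn one_ne_zero A b hgap1
  · have hA := sv_pos_of_rank_eq hn hrank
    have hD := hasFDerivAt_olsMap hn hA b
    have hK := specNorm_olsK hn hA b
    have h2 := olsForm2_eq_olsForm1 hn hA b
    have hlim := tendsto_stlsForm1 hn hA b
    refine ⟨eventually_gap_smul hA b, tendsto_sv_aug_smul A b, tendsto_stlsM_inv hn hA b,
      tendsto_stlsSol hn hA b, ?_, isOLSSolution_olsSol hn hA b, transpose_olsRes hn hA b, hD,
      absCond_eq_specNorm hD, (absCond_eq_specNorm hD).trans hK,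
      (absCond_eq_specNorm hD).trans (hK.trans h2.symm), ?_, hlim, ?_⟩
    · filter_upwards [eventually_sv_pos hn hA b] with d hd
      simp [isOLSSolution_iff_eq hn hd]
    · rw [hK]
      -- The condition number equals `stlsForm1` only under the gap and for λ ≠ 0, hence only for
      -- all small λ > 0.
      refine hlim.congr' ?_
      filter_upwards [eventually_gap_smul hA b, self_mem_nhdsWithin] with lam hgap hlam
      exact (absCond_stlsMap_eq_stlsForm1 hn (ne_of_gt hlam) hgap).symm
    · rw [h2]
      -- This equality rests only on the symmetry of M, so it holds for every λ.
      simpa only [stlsForm2_eq_stlsForm1] using hlim
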